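/- Fix an integer $k\ge 1$, a real number $\epsilon>0$, and a probability distribution $\nu$ on $D_k=\{0,\frac1k,\frac2k,\ldots,\frac{k-1}{k},1\}$ such that $0<\nu(\{a\})=\nu(\{1-a\})$ for every $a\in D_k$. Let $\mu$ and $\sigma$ be the mean and the standard deviation of $\nu$. For each $n$ consider a round-robin tournament with $n$ players (model $M_k$): player $i$ playing against player $j\ne i$ receives a reward $X_{ij}$ with distribution $\nu$, where $X_{ij}+X_{ji}=1$ almost surely, and the $\binom n2$ pairs $(X_{ij},X_{ji})$, $1\le i<j\le n$, are independent. Let $s_i(n)=\sum_{j\ne i}X_{ij}$ be the score of player $i$, and put, for all $n$ large enough that the expression is defined, $$t_n=(n-1)\mu+x_n\,\sigma\sqrt{n-1},\qquad x_n=\bigl[2\log(n-1)-(1+\epsilon)\log\log(n-1)\bigr]^{1/2}.$$ Then $$\lim_{n\to\infty}P\Bigl(\max_{1\le i\le n}s_i(n)>t_n\Bigr)=1.$$ -/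

import Mathlib

open MeasureTheory ProbabilityTheory Filter Topology

namespace RoundRobin

/-- The set of possible payoffs `D_k = {0, 1/k, 2/k, …, (k-1)/k, 1}`. -/
def payoffs (k : ℕ) : Set ℝ := {a | ∃ m : ℕ, m ≤ k ∧ a = (m : ℝ) / (k : ℝ)}

/-- `ν` is a possible law of the reward of a single game: a probability measure carried by `D_k`,
with `0 < P(X = a) = P(X = 1 - a)` for every `a ∈ D_k`. -/
structure IsPayoffLaw (k : ℕ) (ν : Measure ℝ) : Prop where
  isProbabilityMeasure : IsProbabilityMeasure ν
  ae_mem : ∀ᵐ a ∂ν, a ∈ payoffs k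
  pos : ∀ a ∈ payoffs k, 0 < ν {a}
  symm : ∀ a ∈ payoffs k, ν {a} = ν {1 - a}

/-- The round-robin tournament with `n` players under model `M_k`, `ν` being the common law of the
rewards. The reward of player `i` against player `j ≠ i` is `X i j` (the diagonal entries `X i i`
play no role). The pairs `(X i j, X j i)`, `i < j`, are independent. -/
structure IsTournament (k : ℕ) (ν : Measure ℝ) {n : ℕ} {Ω : Type*} [MeasurableSpace Ω]
    (P : Measure Ω) (X : Fin n → Fin n → Ω → ℝ) : Prop where
  isProbabilityMeasure : IsProbabilityMeasure P
  isPayoffLaw : IsPayoffLaw k ν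
  hasLaw : ∀ i j, i ≠ j → HasLaw (X i j) ν P
  add_eq_one : ∀ i j, i ≠ j → ∀ᵐ ω ∂P, X i j ω + X j i ω = 1
  indep : iIndepFun
    (fun (e : {e : Fin n × Fin n // e.1 < e.2}) (ω : Ω) =>
      (X e.1.1 e.1.2 ω, X e.1.2 e.1.1 ω)) P

/-- The score `s_i(n) = ∑_{j ≠ i} X_{ij}` of player `i`. -/
def score {n : ℕ} {Ω : Type*} (X : Fin n → Fin n → Ω → ℝ) (i : Fin n) (ω : Ω) : ℝ :=
  ∑ j ∈ Finset.univ.erase i, X i j ω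

/-- The maximal score `max {s_1(n), …, s_n(n)}` (a maximum over a finite set, non-empty as soon as
`n ≥ 1`). -/
noncomputable def maxScore {n : ℕ} {Ω : Type*} (X : Fin n → Fin n → Ω → ℝ) (ω : Ω) : ℝ :=
  ⨆ i : Fin n, score X i ω

/-- `μ = E(X_{ij})`, a function of the common law of the rewards. -/
noncomputable def mean (ν : Measure ℝ) : ℝ := ∫ a, a ∂ν

/-- `σ = Var(X_{ij})^{1/2}`, a function of the common law of the rewards. -/
noncomputable def stdDev (ν : Measure ℝ) : ℝ := √(Var[fun a : ℝ => a; ν])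

/-- `x_n = [2 log (n - 1) - (1 + ε) log log (n - 1)]^{1/2}` (the radicand is positive for all
large `n`). -/
noncomputable def deviation (ε : ℝ) (n : ℕ) : ℝ :=
  √(2 * Real.log ((n : ℝ) - 1) - (1 + ε) * Real.log (Real.log ((n : ℝ) - 1)))

/-- `t_n = (n - 1) μ + x_n (n - 1)^{1/2} σ`. -/
noncomputable def threshold (ν : Measure ℝ) (ε : ℝ) (n : ℕ) : ℝ :=
  ((n : ℝ) - 1) * mean ν + deviation ε n * √((n : ℝ) - 1) * stdDev ν

end RoundRobin

/-!
The expected number of players whose score exceeds `t_n` tends to infinity, and the scores are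
negatively correlated, so the second moment method shows that some score exceeds `t_n` with
probability tending to `1`.

*Negative correlation.* The scores of players `i ≠ j` are `X i j + U` and `1 - X i j + W`, with
`X i j`, `U`, `W` independent. Conditionally on `X i j` the events that the two scores exceed `t` are
independent, with conditional probabilities respectively monotone and antitone in `X i j`, and
Chebyshev's association inequality gives `P (A i ∩ A j) ≤ P (A i) * P (A j)`
(`IsTournament.measureReal_inter_lt_score_le`). The variance of the number of events `A i` that occur
is thus at most its mean `m`, and `P (⋃ i, A i) ≥ 1 - 1 / m`
(`one_sub_inv_sum_le_measureReal_iUnion`).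

*The mean.* A central limit theorem with an absolute error is useless here, since each event has
probability of order `1 / n` up to powers of `log n`; a moderate deviation bound
`P (A i) ≥ c * exp (-x ^ 2 / 2) / x` is needed. The centred rewards, multiplied by `k`, live on a
translate of `ℤ` and charge two adjacent points. With `M` their moment generating function and `s2`
their variance, the probability that a sum of `N` of them equals `r` is the integral over
`|t| ≤ π` of `M (θ + i t) ^ N * exp (-(θ + i t) * r) / (2 * π)`, for any `θ`. With
`θ = x / √(N * s2)`, and `r` just above the level `x * √(N * s2)`, the function `M z` may be replaced
by `exp (s2 * z ^ 2 / 2)`: the two differ by `O(|z| ^ 3)`, and the two adjacent atoms make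
`|M (θ + i t)|` decay like `exp (-c * t ^ 2)` on all of `[-π, π]`. This bounds the probability of
each lattice point from below (`exists_local_lower_bound`), and summing over a window of length
`1 / θ`, up to a constant, above the level gives the tail bound (`exists_tail_lower_bound`,
`exists_score_tail_lower_bound`).

For `x = x_n` the mean `m` is then at least a constant times `(log (n - 1)) ^ (ε / 2)`
(`eventually_deviation_bounds`).
-/

namespace RoundRobin

/-! ### The moment generating function of a bounded law near the origin -/

section Mgf

variable {ρ : Measure ℝ} [IsProbabilityMeasure ρ] {B : ℝ}

theorem integrable_of_continuous_of_ae_abs_le {E : Type*} [NormedAddCommGroup E] {μ : Measure ℝ}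
    [IsFiniteMeasure μ] (hB : ∀ᵐ v ∂μ, |v| ≤ B) {f : ℝ → E} (hf : Continuous f) :
    Integrable f μ := by
  obtain ⟨C, hC⟩ := (isCompact_Icc (a := -B) (b := B)).exists_bound_of_continuousOn hf.continuousOn
  refine Integrable.of_bound hf.aestronglyMeasurable C ?_
  filter_upwards [hB] with v hv using hC v (abs_le.1 hv)

theorem norm_cexp_sub_quadratic_le (w : ℂ) :
    ‖Complex.exp w - 1 - w - w ^ 2 / 2‖ ≤ ‖w‖ ^ 3 * Real.exp ‖w‖ := by
  have h := Complex.norm_exp_sub_sum_le_norm_mul_exp w 3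
  simp only [Finset.sum_range_succ, Finset.sum_range_zero] at h
  norm_num [Nat.factorial] at h
  convert h using 2
  ring

/-- A centred bounded law with variance `s2` agrees with the Gaussian law of variance `s2` up to an error of
third order at the origin, on the level of (complex) moment generating functions. -/
theorem exists_norm_mgf_sub_gaussian_le (hB : ∀ᵐ v ∂ρ, |v| ≤ B) {s2 : ℝ}
    (hmean : ∫ v, v ∂ρ = 0) (hvar : ∫ v, v ^ 2 ∂ρ = s2) (R : ℝ) :
    ∃ C, 0 ≤ C ∧ ∀ z : ℂ, ‖z‖ ≤ R →
      ‖(∫ v : ℝ, Complex.exp (z * v) ∂ρ) - Complex.exp (s2 * z ^ 2 / 2)‖ ≤ C * ‖z‖ ^ 3 := by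
  have hB0 : ∀ᵐ v ∂ρ, |v| ≤ |B| := hB.mono fun v hv ↦ hv.trans (le_abs_self B)
  have hs2 : 0 ≤ s2 := hvar ▸ integral_nonneg fun v ↦ sq_nonneg v
  refine ⟨|B| ^ 3 * Real.exp (|R| * |B|) + s2 ^ 2 * |R| * Real.exp (s2 * |R| ^ 2), by positivity,
    fun z hz ↦ ?_⟩
  have hzR : ‖z‖ ≤ |R| := hz.trans (le_abs_self R)
  have hz0 := norm_nonneg z
  have h1 : ‖(∫ v : ℝ, Complex.exp (z * v) ∂ρ) - 1 - s2 * z ^ 2 / 2‖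
      ≤ ‖z‖ ^ 3 * (|B| ^ 3 * Real.exp (|R| * |B|)) := by
    have i0 : Integrable (fun v : ℝ ↦ Complex.exp (z * v)) ρ :=
      integrable_of_continuous_of_ae_abs_le hB (by fun_prop)
    have i1 : Integrable (fun v : ℝ ↦ z * (v : ℂ)) ρ :=
      integrable_of_continuous_of_ae_abs_le hB (by fun_prop)
    have i2 : Integrable (fun v : ℝ ↦ (z * (v : ℂ)) ^ 2 / 2) ρ :=
      integrable_of_continuous_of_ae_abs_le hB (by fun_prop)
    have e1 : ∫ v : ℝ, z * (v : ℂ) ∂ρ = 0 := by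
      rw [integral_const_mul, integral_complex_ofReal, hmean]; simp
    have e2 : ∫ v : ℝ, (z * (v : ℂ)) ^ 2 / 2 ∂ρ = s2 * z ^ 2 / 2 := by
      have : ∀ v : ℝ, (z * (v : ℂ)) ^ 2 / 2 = z ^ 2 / 2 * ((v ^ 2 : ℝ) : ℂ) := fun v ↦ by
        push_cast; ring
      simp_rw [this]
      rw [integral_const_mul, integral_complex_ofReal, hvar]; ring
    have key : (∫ v : ℝ, Complex.exp (z * v) ∂ρ) - 1 - s2 * z ^ 2 / 2
        = ∫ v : ℝ, (Complex.exp (z * v) - 1 - z * v - (z * (v : ℂ)) ^ 2 / 2) ∂ρ := by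
      have i3 : Integrable (fun v : ℝ ↦ Complex.exp (z * v) - 1) ρ := i0.sub (integrable_const _)
      have i4 : Integrable (fun v : ℝ ↦ Complex.exp (z * v) - 1 - z * v) ρ := i3.sub i1
      rw [integral_sub i4 i2, integral_sub i3 i1, integral_sub i0 (integrable_const _), e1, e2]
      simp
    rw [key]
    have := norm_integral_le_of_norm_le_const (μ := ρ)
      (f := fun v : ℝ ↦ Complex.exp (z * v) - 1 - z * v - (z * (v : ℂ)) ^ 2 / 2)
      (C := ‖z‖ ^ 3 * (|B| ^ 3 * Real.exp (|R| * |B|))) ?_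
    · simpa using this
    · filter_upwards [hB0] with v hv
      refine (norm_cexp_sub_quadratic_le _).trans ?_
      rw [norm_mul, Complex.norm_real, Real.norm_eq_abs, mul_pow, mul_assoc]
      gcongr
  have h2 : ‖Complex.exp (s2 * z ^ 2 / 2) - 1 - s2 * z ^ 2 / 2‖
      ≤ ‖z‖ ^ 3 * (s2 ^ 2 * |R| * Real.exp (s2 * |R| ^ 2)) := by
    have h := Complex.norm_exp_sub_sum_le_norm_mul_exp (s2 * z ^ 2 / 2) 2
    simp only [Finset.sum_range_succ, Finset.sum_range_zero] at h
    norm_num at h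
    rw [← sub_sub] at h
    rw [abs_of_nonneg hs2] at h
    refine h.trans ?_
    have e : s2 * ‖z‖ ^ 2 / 2 ≤ s2 * |R| ^ 2 := by
      have : s2 * ‖z‖ ^ 2 ≤ s2 * |R| ^ 2 := by gcongr
      have : 0 ≤ s2 * ‖z‖ ^ 2 := by positivity
      linarith
    have e' : (s2 * ‖z‖ ^ 2 / 2) ^ 2 ≤ ‖z‖ ^ 3 * (s2 ^ 2 * |R|) := by
      have : (s2 * ‖z‖ ^ 2 / 2) ^ 2 = ‖z‖ ^ 3 * (s2 ^ 2 * ‖z‖) / 4 := by ring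
      rw [this]
      have h1 : ‖z‖ ^ 3 * (s2 ^ 2 * ‖z‖) ≤ ‖z‖ ^ 3 * (s2 ^ 2 * |R|) := by gcongr
      have h2 : 0 ≤ ‖z‖ ^ 3 * (s2 ^ 2 * ‖z‖) := by positivity
      linarith
    calc _ ≤ (‖z‖ ^ 3 * (s2 ^ 2 * |R|)) * Real.exp (s2 * |R| ^ 2) := by gcongr
      _ = _ := by ring
  calc _ = ‖((∫ v : ℝ, Complex.exp (z * v) ∂ρ) - 1 - s2 * z ^ 2 / 2)
        - (Complex.exp (s2 * z ^ 2 / 2) - 1 - s2 * z ^ 2 / 2)‖ := by congr 1; ring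
    _ ≤ _ := (norm_sub_le _ _).trans (add_le_add h1 h2)
    _ = _ := by ring

theorem sq_div_le_two_sub_cos_sub_cos (α : ℝ) {t : ℝ} (ht : |t| ≤ Real.pi) :
    t ^ 2 / Real.pi ^ 2 ≤ (1 - Real.cos α) + (1 - Real.cos (α + t)) := by
  have h1 : Real.cos α + Real.cos (α + t) = 2 * Real.cos (α + t / 2) * Real.cos (t / 2) := by
    rw [Real.cos_add_cos, ← Real.cos_neg ((α - (α + t)) / 2)]
    ring_nf
  have h2 : |t / 2| ≤ Real.pi := by
    rw [abs_div, abs_two]; linarith [abs_nonneg t, Real.pi_pos]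
  have h3 := Real.cos_le_one_sub_mul_cos_sq h2
  have h4 : 0 ≤ Real.cos (t / 2) := by
    apply Real.cos_nonneg_of_neg_pi_div_two_le_of_le <;> linarith [abs_le.1 ht]
  have h5 := Real.cos_le_one (α + t / 2)
  have h6 : Real.cos (α + t / 2) * Real.cos (t / 2) ≤ Real.cos (t / 2) := by nlinarith
  have h7 : 2 / Real.pi ^ 2 * (t / 2) ^ 2 = t ^ 2 / Real.pi ^ 2 / 2 := by ring
  rw [h7] at h3
  nlinarith

/-- Two atoms at distance `1` make the characteristic function of the tilted law decay
quadratically on the whole of `[-π, π]`, uniformly for bounded tilts. -/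
theorem exists_norm_mgf_le_sub (hB : ∀ᵐ v ∂ρ, |v| ≤ B) {a : ℝ}
    (ha : 0 < ρ {a}) (ha' : 0 < ρ {a + 1}) :
    ∃ c, 0 < c ∧ ∀ θ t : ℝ, 0 ≤ θ → θ ≤ 1 → |t| ≤ Real.pi →
      ‖∫ v : ℝ, Complex.exp ((θ + t * Complex.I) * v) ∂ρ‖
        ≤ (∫ v : ℝ, Real.exp (θ * v) ∂ρ) - c * t ^ 2 := by
  have hr : 0 < ρ.real {a} := ENNReal.toReal_pos ha.ne' (measure_ne_top _ _)
  have hr' : 0 < ρ.real {a + 1} := ENNReal.toReal_pos ha'.ne' (measure_ne_top _ _)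
  set w := min (ρ.real {a}) (ρ.real {a + 1}) * Real.exp (-(|a| + 1)) with hw
  have hwpos : 0 < w := by positivity
  refine ⟨w / Real.pi ^ 2, by positivity, fun θ t h0 h1 ht ↦ ?_⟩
  set I := ∫ v : ℝ, Complex.exp ((θ + t * Complex.I) * v) ∂ρ with hI
  set φ := Complex.arg I
  have i0 : Integrable (fun v : ℝ ↦ Complex.exp ((θ + t * Complex.I) * v)) ρ :=
    integrable_of_continuous_of_ae_abs_le hB (by fun_prop)
  have i1 : Integrable (fun v : ℝ ↦ Real.exp (θ * v)) ρ :=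
    integrable_of_continuous_of_ae_abs_le hB (by fun_prop)
  have i2 : Integrable (fun v : ℝ ↦ Real.exp (θ * v) * Real.cos (t * v - φ)) ρ :=
    integrable_of_continuous_of_ae_abs_le hB (by fun_prop)
  -- Rotating the integral onto the positive axis turns its modulus into a real integral.
  have hnorm : ‖I‖ = ∫ v : ℝ, Real.exp (θ * v) * Real.cos (t * v - φ) ∂ρ := by
    have e1 : (‖I‖ : ℂ) = ∫ v : ℝ, Complex.exp (-(φ * Complex.I))
        * Complex.exp ((θ + t * Complex.I) * v) ∂ρ := by
      rw [integral_const_mul, ← hI]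
      conv_rhs => rw [← Complex.norm_mul_exp_arg_mul_I I]
      rw [mul_left_comm, ← Complex.exp_add]
      simp [φ]
    have e2 : ‖I‖ = (∫ v : ℝ, Complex.exp (-(φ * Complex.I))
        * Complex.exp ((θ + t * Complex.I) * v) ∂ρ).re := by rw [← e1]; simp
    rw [e2]
    have := integral_re (μ := ρ) (i0.const_mul (Complex.exp (-(φ * Complex.I))))
    refine Eq.trans this.symm (integral_congr_ae (ae_of_all _ fun v ↦ ?_))
    simp only [RCLike.re_to_complex]
    rw [← Complex.exp_add, Complex.exp_re]
    congr 2 <;> simp <;> ring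
  have hdiff : (∫ v : ℝ, Real.exp (θ * v) ∂ρ) - ‖I‖
      = ∫ v : ℝ, Real.exp (θ * v) * (1 - Real.cos (t * v - φ)) ∂ρ := by
    rw [hnorm, ← integral_sub i1 i2]
    congr 1; ext v; ring
  set g : ℝ → ℝ := fun v ↦ Real.exp (θ * v) * (1 - Real.cos (t * v - φ)) with hg
  have hg0 : ∀ v, 0 ≤ g v := fun v ↦
    mul_nonneg (Real.exp_pos _).le (by linarith [Real.cos_le_one (t * v - φ)])
  have ig : Integrable g ρ := integrable_of_continuous_of_ae_abs_le hB (by fun_prop)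
  have hset : ρ.real {a} * g a + ρ.real {a + 1} * g (a + 1) ≤ ∫ v, g v ∂ρ := by
    have h := setIntegral_le_integral (s := {a} ∪ {a + 1}) ig (ae_of_all _ hg0)
    rw [setIntegral_union (by simp) (measurableSet_singleton _) ig.integrableOn ig.integrableOn,
      integral_singleton, integral_singleton] at h
    simpa using h
  have hexp : ∀ v, |v| ≤ |a| + 1 → -(|a| + 1) ≤ θ * v := fun v hv ↦ by
    have : |θ * v| ≤ |a| + 1 := by
      rw [abs_mul, abs_of_nonneg h0]
      nlinarith [abs_nonneg v]
    linarith [neg_abs_le (θ * v)]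
  have hA : w * (1 - Real.cos (t * a - φ)) ≤ ρ.real {a} * g a := by
    simp only [hg, hw]
    rw [← mul_assoc]
    gcongr
    · linarith [Real.cos_le_one (t * a - φ)]
    · exact min_le_left _ _
    · exact hexp a (by linarith)
  have hA' : w * (1 - Real.cos (t * a - φ + t)) ≤ ρ.real {a + 1} * g (a + 1) := by
    simp only [hg, hw]
    rw [← mul_assoc, show t * (a + 1) - φ = t * a - φ + t by ring]
    gcongr
    · linarith [Real.cos_le_one (t * a - φ + t)]
    · exact min_le_right _ _
    · exact hexp (a + 1) ((abs_add_le _ _).trans (by simp))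
  have hcos := mul_le_mul_of_nonneg_left (sq_div_le_two_sub_cos_sub_cos (t * a - φ) ht) hwpos.le
  have : w / Real.pi ^ 2 * t ^ 2 = w * (t ^ 2 / Real.pi ^ 2) := by ring
  rw [this]
  linarith

end Mgf

/-! ### Gaussian approximation of powers of the moment generating function -/

theorem norm_pow_sub_pow_le_mul {x y : ℂ} {q : ℝ} (hx : ‖x‖ ≤ q) (hy : ‖y‖ ≤ q) (n : ℕ) :
    ‖x ^ n - y ^ n‖ ≤ n * ‖x - y‖ * q ^ (n - 1) := by
  rw [← Commute.geom_sum₂_mul (Commute.all x y), norm_mul]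
  have hq : 0 ≤ q := (norm_nonneg x).trans hx
  have : ‖∑ i ∈ Finset.range n, x ^ i * y ^ (n - 1 - i)‖ ≤ n * q ^ (n - 1) := by
    refine (norm_sum_le_of_le (f := fun i ↦ x ^ i * y ^ (n - 1 - i)) (n := fun _ ↦ q ^ (n - 1)) _
      fun i hi ↦ ?_).trans (by simp)
    have hi' : i + (n - 1 - i) = n - 1 := by have := Finset.mem_range.1 hi; omega
    rw [norm_mul, norm_pow, norm_pow, ← hi', pow_add]
    simp only [add_tsub_cancel_left]
    gcongr
  calc _ ≤ n * q ^ (n - 1) * ‖x - y‖ := by gcongr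
    _ = _ := by ring

theorem pow_three_le_mul_exp {c : ℝ} (hc : 0 < c) {u : ℝ} (hu : 0 ≤ u) :
    u ^ 3 ≤ (1 + 2 / c ^ 2) * Real.exp (c * u ^ 2) := by
  have h0 : 0 ≤ c * u ^ 2 := by positivity
  have h1 := Real.quadratic_le_exp_of_nonneg h0
  have h2 : u ^ 3 ≤ 1 + u ^ 4 := by nlinarith [sq_nonneg (u ^ 2 - u), sq_nonneg (u - 1), sq_nonneg u]
  have h3 : u ^ 4 = 2 / c ^ 2 * ((c * u ^ 2) ^ 2 / 2) := by field_simp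
  have h4 : (c * u ^ 2) ^ 2 / 2 ≤ Real.exp (c * u ^ 2) := by linarith
  have h5 : 1 ≤ Real.exp (c * u ^ 2) := Real.one_le_exp h0
  calc u ^ 3 ≤ 1 + u ^ 4 := h2
    _ ≤ Real.exp (c * u ^ 2) + 2 / c ^ 2 * Real.exp (c * u ^ 2) := by rw [h3]; gcongr
    _ = _ := by ring

section Mgf

variable {ρ : Measure ℝ} [IsProbabilityMeasure ρ] {B : ℝ}

/-- The `N`-th power of the moment generating function on the line `Re z = θ` is close to its
Gaussian counterpart, relative to the value `exp (s2 * θ ^ 2 / 2) ^ N` at `θ`. -/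
theorem exists_norm_mgf_pow_sub_gaussian_le (hB : ∀ᵐ v ∂ρ, |v| ≤ B) {s2 a : ℝ}
    (hmean : ∫ v, v ∂ρ = 0) (hvar : ∫ v, v ^ 2 ∂ρ = s2) (hs2 : 0 < s2)
    (ha : 0 < ρ {a}) (ha' : 0 < ρ {a + 1}) :
    ∃ K c, 0 ≤ K ∧ 0 < c ∧ c ≤ s2 / 4 ∧ ∀ (N : ℕ) (θ t : ℝ), 2 ≤ N → 0 ≤ θ → θ ≤ 1 →
      |t| ≤ Real.pi → N * θ ^ 3 ≤ 1 →
      ‖(∫ v : ℝ, Complex.exp ((θ + t * Complex.I) * v) ∂ρ) ^ N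
          - Complex.exp (s2 * (θ + t * Complex.I) ^ 2 / 2) ^ N‖
        ≤ Real.exp (s2 * θ ^ 2 / 2) ^ N * (K * (N * θ ^ 3 + 1 / √N) * Real.exp (-(c * N * t ^ 2))) := by
  obtain ⟨C, hC0, hC⟩ := exists_norm_mgf_sub_gaussian_le hB hmean hvar 5
  obtain ⟨c0, hc0, hc⟩ := exists_norm_mgf_le_sub hB ha ha'
  set D := Real.exp (s2 / 2)
  -- The decay rate `c` is available for both `M` and the Gaussian factor, after division by `A ≤ D`.
  set c := min (c0 / D) (s2 / 2)
  have hcpos : 0 < c := by positivity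
  have hcs : c ≤ s2 / 2 := min_le_right _ _
  set K1 := 1 + 2 / (c / 4) ^ 2
  have hK1 : 1 ≤ K1 := by simp only [K1]; linarith [show 0 ≤ 2 / (c / 4) ^ 2 by positivity]
  refine ⟨4 * C * Real.exp C * K1, c / 4, by positivity, by positivity, by linarith,
    fun N θ t hN h0 h1 ht hNθ ↦ ?_⟩
  have hN0 : (0 : ℝ) < N := by positivity
  set A := Real.exp (s2 * θ ^ 2 / 2) with hA
  have hA1 : 1 ≤ A := Real.one_le_exp (by positivity)
  have hAD : A ≤ D := Real.exp_le_exp.2 (by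
    have := mul_le_mul_of_nonneg_left (pow_le_one₀ h0 h1 (n := 2)) hs2.le
    linarith)
  set z : ℂ := θ + t * Complex.I with hz
  set M := ∫ v : ℝ, Complex.exp (z * v) ∂ρ with hM
  set G := Complex.exp (s2 * z ^ 2 / 2) with hG
  have hznorm : ‖z‖ ≤ θ + |t| := by
    refine (norm_add_le _ _).trans ?_
    simp [abs_of_nonneg h0]
  have hz5 : ‖z‖ ≤ 5 := by linarith [Real.pi_lt_four]
  have hMθ : ∫ v : ℝ, Real.exp (θ * v) ∂ρ ≤ A + C * θ ^ 3 := by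
    have h := hC θ (by simp [abs_of_nonneg h0]; linarith)
    have e1 : (∫ v : ℝ, Complex.exp ((θ : ℂ) * v) ∂ρ) = ((∫ v : ℝ, Real.exp (θ * v) ∂ρ : ℝ) : ℂ) := by
      rw [← integral_complex_ofReal]; congr 1; ext v; push_cast; rfl
    have e2 : Complex.exp (s2 * (θ : ℂ) ^ 2 / 2) = (A : ℂ) := by rw [hA]; push_cast; rfl
    rw [e1, e2, ← Complex.ofReal_sub, Complex.norm_real, Complex.norm_real, Real.norm_eq_abs,
      Real.norm_eq_abs, abs_of_nonneg h0] at h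
    linarith [le_abs_self ((∫ v : ℝ, Real.exp (θ * v) ∂ρ) - A)]
  set q := A * Real.exp (C * θ ^ 3 - c * t ^ 2) with hq
  have hMq : ‖M‖ ≤ q := by
    have h := hc θ t h0 h1 ht
    have e : c * A ≤ c0 := by
      calc c * A ≤ c0 / D * D := by gcongr; exact min_le_left _ _
        _ = c0 := by field_simp [D]
    have hCA : C * θ ^ 3 ≤ A * (C * θ ^ 3) := le_mul_of_one_le_left (by positivity) hA1
    have ht2 : c * A * t ^ 2 ≤ c0 * t ^ 2 := by gcongr
    calc ‖M‖ ≤ A + C * θ ^ 3 - c0 * t ^ 2 := by linarith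
      _ ≤ A * ((C * θ ^ 3 - c * t ^ 2) + 1) := by linarith
      _ ≤ q := mul_le_mul_of_nonneg_left (Real.add_one_le_exp _) (by linarith)
  have hGnorm : ‖G‖ = A * Real.exp (-(s2 * t ^ 2 / 2)) := by
    rw [hG, Complex.norm_exp, hA, ← Real.exp_add, hz]
    congr 1
    have : ((s2 : ℂ) * (θ + t * Complex.I) ^ 2 / 2)
        = ((s2 * θ ^ 2 / 2 - s2 * t ^ 2 / 2 : ℝ) : ℂ) + ((s2 * θ * t : ℝ) : ℂ) * Complex.I := by
      push_cast; ring_nf; rw [Complex.I_sq]; ring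
    rw [this, Complex.add_re, Complex.re_ofReal_mul, Complex.ofReal_re, Complex.I_re]; ring
  have hGq : ‖G‖ ≤ q := by
    rw [hGnorm, hq]
    gcongr
    have : c * t ^ 2 ≤ s2 / 2 * t ^ 2 := by gcongr
    have : 0 ≤ C * θ ^ 3 := by positivity
    linarith
  have hMG : ‖M - G‖ ≤ 4 * C * (θ ^ 3 + |t| ^ 3) := by
    refine (hC z hz5).trans ?_
    have h : ‖z‖ ^ 3 ≤ (θ + |t|) ^ 3 := by gcongr
    have h' : (θ + |t|) ^ 3 ≤ 4 * (θ ^ 3 + |t| ^ 3) := by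
      nlinarith [mul_nonneg (add_nonneg h0 (abs_nonneg t)) (sq_nonneg (θ - |t|))]
    calc C * ‖z‖ ^ 3 ≤ C * (4 * (θ ^ 3 + |t| ^ 3)) := by gcongr; linarith
      _ = _ := by ring
  have hqN : q ^ (N - 1) ≤ A ^ N * (Real.exp C * Real.exp (-(c * N * t ^ 2 / 2))) := by
    rw [hq, mul_pow, ← Real.exp_nat_mul (C * θ ^ 3 - c * t ^ 2), ← Real.exp_add C]
    have hsub : ((N - 1 : ℕ) : ℝ) = N - 1 := by
      rw [Nat.cast_sub (by omega)]; simp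
    have hN2 : (2 : ℝ) ≤ N := by exact_mod_cast hN
    apply mul_le_mul (pow_le_pow_right₀ hA1 (by omega)) _ (Real.exp_pos _).le (by positivity)
    · apply Real.exp_le_exp.2
      rw [hsub]
      have e1 : (N : ℝ) * (C * θ ^ 3) ≤ C := by nlinarith
      have e2 : 0 ≤ C * θ ^ 3 := by positivity
      have e3 : 0 ≤ c * t ^ 2 := by positivity
      nlinarith
  -- Part of the Gaussian decay absorbs the factor `|t| ^ 3`, which then counts as `N ^ (-3 / 2)`.
  have hcube : N * |t| ^ 3 * Real.exp (-(c * N * t ^ 2 / 4)) ≤ K1 * (1 / √N) := by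
    have h := pow_three_le_mul_exp (c := c / 4) (by positivity) (u := √N * |t|) (by positivity)
    have hs : √(N : ℝ) ^ 2 = N := Real.sq_sqrt hN0.le
    have e1 : (√N * |t|) ^ 3 = √N * (N * |t| ^ 3) := by
      rw [mul_pow, pow_succ, hs]; ring
    have e2 : c / 4 * (√N * |t|) ^ 2 = c * N * t ^ 2 / 4 := by
      rw [mul_pow, hs, sq_abs]; ring
    rw [e1, e2] at h
    rw [Real.exp_neg, mul_one_div, le_div_iff₀ (by positivity), ← div_eq_mul_inv, div_mul_eq_mul_div,
      div_le_iff₀ (by positivity)]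
    linarith
  have hsplit : Real.exp (-(c * N * t ^ 2 / 2))
      = Real.exp (-(c * N * t ^ 2 / 4)) * Real.exp (-(c / 4 * N * t ^ 2)) := by
    rw [← Real.exp_add]; congr 1; ring
  have hE1 : Real.exp (-(c * N * t ^ 2 / 4)) ≤ 1 := by
    apply Real.exp_le_one_iff.2
    have : 0 ≤ c * N * t ^ 2 := by positivity
    linarith
  calc ‖M ^ N - G ^ N‖ ≤ N * ‖M - G‖ * q ^ (N - 1) := norm_pow_sub_pow_le_mul hMq hGq N
    _ ≤ N * (4 * C * (θ ^ 3 + |t| ^ 3))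
        * (A ^ N * (Real.exp C * Real.exp (-(c * N * t ^ 2 / 2)))) := by gcongr
    _ = A ^ N * (4 * C * Real.exp C * (N * θ ^ 3 * Real.exp (-(c * N * t ^ 2 / 4))
        + N * |t| ^ 3 * Real.exp (-(c * N * t ^ 2 / 4))) * Real.exp (-(c / 4 * N * t ^ 2))) := by
      rw [hsplit]; ring
    _ ≤ A ^ N * (4 * C * Real.exp C * (K1 * (N * θ ^ 3) + K1 * (1 / √N))
        * Real.exp (-(c / 4 * N * t ^ 2))) := by
      have : N * θ ^ 3 * Real.exp (-(c * N * t ^ 2 / 4)) ≤ K1 * (N * θ ^ 3) :=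
        calc N * θ ^ 3 * Real.exp (-(c * N * t ^ 2 / 4)) ≤ N * θ ^ 3 * 1 := by gcongr
          _ ≤ K1 * (N * θ ^ 3) := by rw [mul_one]; exact le_mul_of_one_le_left (by positivity) hK1
      have := add_le_add this hcube
      gcongr
    _ = _ := by ring

/-- Pointwise lower bound for the integrand of the inversion formula at a point within
`η * √N` of the tilted mean `N * s2 * θ`. -/
theorem exists_le_re_mgf_pow_mul_exp (hB : ∀ᵐ v ∂ρ, |v| ≤ B) {s2 a : ℝ}
    (hmean : ∫ v, v ∂ρ = 0) (hvar : ∫ v, v ^ 2 ∂ρ = s2) (hs2 : 0 < s2)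
    (ha : 0 < ρ {a}) (ha' : 0 < ρ {a + 1}) :
    ∃ K c, 0 ≤ K ∧ 0 < c ∧ ∀ (N : ℕ) (θ t y η : ℝ), 2 ≤ N → 0 ≤ θ → θ ≤ 1 →
      |t| ≤ Real.pi → N * θ ^ 3 ≤ 1 → |y| ≤ η * √N →
      Real.exp (-(N * s2 * θ ^ 2 / 2 + θ * y)) * (Real.exp (-(N * s2 * t ^ 2 / 2))
          - K * (η ^ 2 + N * θ ^ 3 + 1 / √N) * Real.exp (-(c * N * t ^ 2)))
        ≤ ((∫ v : ℝ, Complex.exp ((θ + t * Complex.I) * v) ∂ρ) ^ N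
          * Complex.exp (-((θ + t * Complex.I) * (N * s2 * θ + y : ℝ)))).re := by
  obtain ⟨K, c, hK, hc, hcs, h⟩ := exists_norm_mgf_pow_sub_gaussian_le hB hmean hvar hs2 ha ha'
  refine ⟨K + 2 / s2, c, by positivity, hc, fun N θ t y η hN h0 h1 ht hNθ hy ↦ ?_⟩
  have hN0 : (0 : ℝ) < N := by positivity
  specialize h N θ t hN h0 h1 ht hNθ
  set z : ℂ := θ + t * Complex.I with hz
  set M := ∫ v : ℝ, Complex.exp (z * v) ∂ρ with hM
  set r : ℝ := N * s2 * θ + y with hr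
  set E := Real.exp (-(c * N * t ^ 2)) with hE
  set F := Real.exp (-(N * s2 * θ ^ 2 / 2 + θ * y)) with hF
  have hnorm : ‖Complex.exp (-(z * r))‖ = Real.exp (-(θ * r)) := by
    rw [Complex.norm_exp, hz]; simp
  have hscale : Real.exp (s2 * θ ^ 2 / 2) ^ N * Real.exp (-(θ * r)) = F := by
    rw [← Real.exp_nat_mul, ← Real.exp_add, hF, hr]; congr 1; ring
  have hmain : (Complex.exp (s2 * z ^ 2 / 2) ^ N * Complex.exp (-(z * r))).re
      = F * (Real.exp (-(N * s2 * t ^ 2 / 2)) * Real.cos (t * y)) := by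
    have : (N : ℂ) * (s2 * z ^ 2 / 2) + -(z * r)
        = ((-(N * s2 * θ ^ 2 / 2 + θ * y) + -(N * s2 * t ^ 2 / 2) : ℝ) : ℂ)
          + ((-(t * y) : ℝ) : ℂ) * Complex.I := by
      rw [hz, hr]; push_cast; ring_nf; rw [Complex.I_sq]; ring
    rw [← Complex.exp_nat_mul, ← Complex.exp_add, this, Complex.exp_re, hF, ← mul_assoc,
      ← Real.exp_add]
    simp only [Complex.add_re, Complex.add_im, Complex.re_ofReal_mul, Complex.im_ofReal_mul,
      Complex.ofReal_re, Complex.ofReal_im, Complex.I_re, Complex.I_im, mul_zero, mul_one, add_zero,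
      zero_add, Real.cos_neg]
  have herr : -(F * (K * (N * θ ^ 3 + 1 / √N) * E))
      ≤ ((M ^ N - Complex.exp (s2 * z ^ 2 / 2) ^ N) * Complex.exp (-(z * r))).re := by
    refine (abs_le.1 ((Complex.abs_re_le_norm _).trans ?_)).1
    rw [norm_mul, hnorm, ← hscale]
    calc _ ≤ Real.exp (s2 * θ ^ 2 / 2) ^ N * (K * (N * θ ^ 3 + 1 / √N) * E)
          * Real.exp (-(θ * r)) := by gcongr
      _ = _ := by ring
  -- As `|y| ≤ η * √N`, the oscillation `cos (t * y)` is negligible wherever the Gaussian is not.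
  have hcos : Real.exp (-(N * s2 * t ^ 2 / 2)) - 2 / s2 * η ^ 2 * E
      ≤ Real.exp (-(N * s2 * t ^ 2 / 2)) * Real.cos (t * y) := by
    have hs : √(N : ℝ) ^ 2 = N := Real.sq_sqrt hN0.le
    have hy2 : y ^ 2 ≤ η ^ 2 * N := by
      rw [← sq_abs y, ← hs, ← mul_pow]; gcongr
    have h1 := Real.one_sub_sq_div_two_le_cos (x := t * y)
    have h2 : (t * y) ^ 2 / 2 ≤ η ^ 2 * (2 / s2) * (N * s2 * t ^ 2 / 4) := by
      have : η ^ 2 * (2 / s2) * (N * s2 * t ^ 2 / 4) = t ^ 2 * (η ^ 2 * N) / 2 := by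
        field_simp; ring
      rw [this, mul_pow]; gcongr
    have h3 : N * s2 * t ^ 2 / 4 ≤ Real.exp (N * s2 * t ^ 2 / 4) := by
      linarith [Real.add_one_le_exp (N * s2 * t ^ 2 / 4)]
    have h4 : Real.exp (-(N * s2 * t ^ 2 / 2)) * Real.exp (N * s2 * t ^ 2 / 4) ≤ E := by
      rw [← Real.exp_add, hE]
      apply Real.exp_le_exp.2
      have : c * (N * t ^ 2) ≤ s2 / 4 * (N * t ^ 2) := by gcongr
      linarith
    have h5 : Real.exp (-(N * s2 * t ^ 2 / 2)) * ((t * y) ^ 2 / 2) ≤ η ^ 2 * (2 / s2) * E := by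
      calc _ ≤ Real.exp (-(N * s2 * t ^ 2 / 2))
            * (η ^ 2 * (2 / s2) * Real.exp (N * s2 * t ^ 2 / 4)) := by
            gcongr; exact h2.trans (by gcongr)
        _ = η ^ 2 * (2 / s2)
            * (Real.exp (-(N * s2 * t ^ 2 / 2)) * Real.exp (N * s2 * t ^ 2 / 4)) := by ring
        _ ≤ _ := by gcongr
    have h6 := mul_le_mul_of_nonneg_left h1 (Real.exp_pos (-(N * s2 * t ^ 2 / 2))).le
    linarith
  have hsum : (M ^ N * Complex.exp (-(z * r))).re
      = (Complex.exp (s2 * z ^ 2 / 2) ^ N * Complex.exp (-(z * r))).re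
        + ((M ^ N - Complex.exp (s2 * z ^ 2 / 2) ^ N) * Complex.exp (-(z * r))).re := by
    rw [← Complex.add_re]; congr 1; ring
  rw [hsum, hmain]
  have hF0 : 0 < F := Real.exp_pos _
  have hE0 : 0 < E := Real.exp_pos _
  have h7 := mul_le_mul_of_nonneg_left hcos hF0.le
  calc _ = F * (Real.exp (-(N * s2 * t ^ 2 / 2)) - 2 / s2 * η ^ 2 * E)
        - F * (K * (N * θ ^ 3 + 1 / √N) * E)
        - F * (K * (η ^ 2) * E + 2 / s2 * (N * θ ^ 3 + 1 / √N) * E) := by ring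
    _ ≤ _ := by
      have : 0 ≤ F * (K * (η ^ 2) * E + 2 / s2 * (N * θ ^ 3 + 1 / √N) * E) := by positivity
      linarith

end Mgf

/-! ### Fourier inversion and a local lower bound for lattice sums -/

theorem integral_cexp_mul_intCast (θ : ℝ) (m : ℤ) :
    ∫ t in -Real.pi..Real.pi, Complex.exp ((θ + t * Complex.I) * m)
      = if m = 0 then 2 * (Real.pi : ℂ) else 0 := by
  split_ifs with hm
  · subst hm
    simp only [Int.cast_zero, mul_zero, Complex.exp_zero, intervalIntegral.integral_const]
    rw [Complex.real_smul]; push_cast; ring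
  · have h0 : (m : ℂ) * Complex.I ≠ 0 := by simp [hm]
    have e : ∀ t : ℝ, Complex.exp ((θ + t * Complex.I) * m)
        = Complex.exp (θ * m) * Complex.exp ((m * Complex.I) * t) := fun t ↦ by
      rw [← Complex.exp_add]; congr 1; ring
    simp_rw [e]
    rw [intervalIntegral.integral_const_mul, integral_exp_mul_complex h0]
    have : Complex.exp (m * Complex.I * (Real.pi : ℝ))
        = Complex.exp (m * Complex.I * (-Real.pi : ℝ)) :=
      Complex.exp_eq_exp_iff_exists_int.2 ⟨m, by push_cast; ring⟩
    rw [this, sub_self, zero_div, mul_zero]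

section

variable {Ω : Type*} [MeasurableSpace Ω] {P : Measure Ω}

/-- Fourier inversion, along the line `Re z = θ`, for a bounded random variable carried by the
lattice `r + ℤ`. -/
theorem two_pi_mul_measureReal_eq [IsProbabilityMeasure P] {T : Ω → ℝ} (hT : AEMeasurable T P)
    {B : ℝ} (hB : ∀ᵐ ω ∂P, |T ω| ≤ B) {r : ℝ} (hr : ∀ᵐ ω ∂P, ∃ m : ℤ, T ω = r + m) (θ : ℝ) :
    ((2 * Real.pi * P.real {ω | T ω = r} : ℝ) : ℂ)
      = ∫ t in -Real.pi..Real.pi, ∫ ω, Complex.exp ((θ + t * Complex.I) * (T ω - r : ℝ)) ∂P := by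
  have hpi : -Real.pi ≤ Real.pi := by linarith [Real.pi_pos]
  have hint : Integrable (Function.uncurry fun (t : ℝ) (ω : Ω) ↦
      Complex.exp ((θ + t * Complex.I) * (T ω - r : ℝ)))
      ((volume.restrict (Set.Ioc (-Real.pi) Real.pi)).prod P) := by
    refine Integrable.of_bound ?_ (Real.exp (|θ| * (B + |r|))) ?_
    · have hT' : AEMeasurable (fun p : ℝ × Ω ↦ T p.2)
          ((volume.restrict (Set.Ioc (-Real.pi) Real.pi)).prod P) := hT.comp_snd
      refine AEMeasurable.aestronglyMeasurable ?_
      simp only [Function.uncurry_def]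
      fun_prop
    · have hB' : ∀ᵐ p ∂((volume.restrict (Set.Ioc (-Real.pi) Real.pi)).prod P), |T p.2| ≤ B :=
        Measure.quasiMeasurePreserving_snd.ae hB
      filter_upwards [hB'] with p hp
      simp only [Function.uncurry_def, Complex.norm_exp]
      apply Real.exp_le_exp.2
      have : ((θ + p.1 * Complex.I) * ((T p.2 - r : ℝ) : ℂ)).re = θ * (T p.2 - r) := by simp
      rw [this]
      refine (le_abs_self _).trans ?_
      rw [abs_mul]
      gcongr
      exact (abs_sub _ _).trans (by gcongr)
  rw [intervalIntegral.integral_of_le hpi, integral_integral_swap hint]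
  have h1 : ∀ᵐ ω ∂P, ∫ t in Set.Ioc (-Real.pi) Real.pi,
      Complex.exp ((θ + t * Complex.I) * (T ω - r : ℝ))
      = Set.indicator {ω | T ω = r} (fun _ ↦ 2 * (Real.pi : ℂ)) ω := by
    filter_upwards [hr] with ω ⟨m, hm⟩
    rw [← intervalIntegral.integral_of_le hpi]
    have := integral_cexp_mul_intCast θ m
    have e : ((T ω - r : ℝ) : ℂ) = m := by rw [hm]; push_cast; ring
    rw [e, this]
    simp [Set.indicator_apply, hm]
  have h2 : NullMeasurableSet {ω | T ω = r} P := hT.nullMeasurable (measurableSet_singleton r)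
  rw [integral_congr_ae h1, integral_indicator₀ h2, setIntegral_const, Complex.real_smul]
  push_cast; ring

variable {ι : Type*} [Fintype ι] {V : ι → Ω → ℝ} {ρ : Measure ℝ}

theorem integral_cexp_mul_sum_sub (hV : ∀ j, HasLaw (V j) ρ P) (hind : iIndepFun V P) (z : ℂ)
    (r : ℝ) :
    ∫ ω, Complex.exp (z * (∑ j, V j ω - r : ℝ)) ∂P
      = (∫ v : ℝ, Complex.exp (z * v) ∂ρ) ^ Fintype.card ι * Complex.exp (-(z * r)) := by
  have e : ∀ ω, Complex.exp (z * (∑ j, V j ω - r : ℝ))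
      = (∏ j, Complex.exp (z * V j ω)) * Complex.exp (-(z * r)) := fun ω ↦ by
    rw [← Complex.exp_sum, ← Complex.exp_add]
    congr 1
    push_cast
    rw [mul_sub, Finset.mul_sum, sub_eq_add_neg]
  simp_rw [e]
  rw [integral_mul_const, hind.integral_fun_prod_comp (f := fun _ (v : ℝ) ↦ Complex.exp (z * v))
    (fun j ↦ (hV j).aemeasurable) (fun j ↦ by fun_prop)]
  congr 1
  have : ∀ j, ∫ ω, Complex.exp (z * V j ω) ∂P = ∫ v : ℝ, Complex.exp (z * v) ∂ρ := fun j ↦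
    (hV j).integral_comp (f := fun v : ℝ ↦ Complex.exp (z * v)) (by fun_prop)
  simp [this]

end

theorem div_sqrt_le_integral_exp_neg_mul_sq {s2 : ℝ} (hs2 : 0 ≤ s2) {N : ℕ} (hN : 1 ≤ N) :
    2 * Real.exp (-(s2 / 2)) / √N
      ≤ ∫ t in -Real.pi..Real.pi, Real.exp (-(N * s2 * t ^ 2 / 2)) := by
  have hN' : (1 : ℝ) ≤ N := by exact_mod_cast hN
  have hsN : 1 ≤ √(N : ℝ) := Real.one_le_sqrt.2 hN'
  have hs : √(N : ℝ) ^ 2 = N := Real.sq_sqrt (by linarith)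
  have h1 : 1 / √(N : ℝ) ≤ 1 := (div_le_one (by linarith)).2 hsN
  have hpos : 0 < 1 / √(N : ℝ) := by positivity
  have hpi := Real.pi_gt_three
  have hc : Continuous fun t : ℝ ↦ Real.exp (-(N * s2 * t ^ 2 / 2)) := by fun_prop
  calc 2 * Real.exp (-(s2 / 2)) / √N
      = ∫ t in -(1 / √(N : ℝ))..(1 / √N), Real.exp (-(s2 / 2)) := by
        rw [intervalIntegral.integral_const, smul_eq_mul]; ring
    _ ≤ ∫ t in -(1 / √(N : ℝ))..(1 / √N), Real.exp (-(N * s2 * t ^ 2 / 2)) := by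
        refine intervalIntegral.integral_mono_on (by linarith) (by simp)
          (hc.intervalIntegrable _ _) fun t ht ↦ Real.exp_le_exp.2 ?_
        have h2 : t ^ 2 ≤ (1 / √(N : ℝ)) ^ 2 := sq_le_sq' ht.1 ht.2
        have h3 : N * s2 * t ^ 2 ≤ N * s2 * (1 / √(N : ℝ)) ^ 2 := by gcongr
        have h4 : N * s2 * (1 / √(N : ℝ)) ^ 2 = s2 := by rw [div_pow, hs]; field_simp
        linarith
    _ ≤ _ := intervalIntegral.integral_mono_interval (by linarith) (by linarith) (by linarith)
        (ae_of_all _ fun t ↦ (Real.exp_pos _).le) (hc.intervalIntegrable _ _)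

theorem integral_exp_neg_mul_sq_le {c : ℝ} (hc : 0 < c) {N : ℕ} (hN : 1 ≤ N) :
    ∫ t in -Real.pi..Real.pi, Real.exp (-(c * N * t ^ 2)) ≤ √(Real.pi / c) / √N := by
  have hN' : (0 : ℝ) < N := by positivity
  rw [intervalIntegral.integral_of_le (by linarith [Real.pi_pos])]
  calc _ ≤ ∫ t : ℝ, Real.exp (-(c * N * t ^ 2)) := by
        refine setIntegral_le_integral ?_ (ae_of_all _ fun t ↦ (Real.exp_pos _).le)
        simpa [neg_mul] using integrable_exp_neg_mul_sq (b := c * N) (by positivity)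
    _ = ∫ t : ℝ, Real.exp (-(c * N) * t ^ 2) := by simp [neg_mul]
    _ = √(Real.pi / (c * N)) := integral_gaussian _
    _ = _ := by rw [← div_div, Real.sqrt_div (by positivity)]

section

universe u v

/-- Local lower bound for a sum `S` of `N` independent copies of a centred bounded lattice variable:
every lattice point within `δ * √N` of the tilted mean `N * s2 * θ` carries at least a constant
multiple of the Gaussian mass `exp (-(N * s2 * θ ^ 2 / 2 + θ * y)) / √N`. -/
theorem exists_local_lower_bound {ρ : Measure ℝ} [IsProbabilityMeasure ρ] {B s2 a : ℝ}
    (hB : ∀ᵐ v ∂ρ, |v| ≤ B) (hmean : ∫ v, v ∂ρ = 0) (hvar : ∫ v, v ^ 2 ∂ρ = s2) (hs2 : 0 < s2)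
    (hlat : ∀ᵐ v ∂ρ, ∃ m : ℤ, v = a + m) (ha : 0 < ρ {a}) (ha' : 0 < ρ {a + 1}) :
    ∃ c δ, 0 < c ∧ 0 < δ ∧ δ ≤ 1 ∧ ∀ (ι : Type u) [Fintype ι] (Ω : Type v) [MeasurableSpace Ω]
      (P : Measure Ω) [IsProbabilityMeasure P] (V : ι → Ω → ℝ), (∀ j, HasLaw (V j) ρ P) →
      iIndepFun V P → ∀ θ y : ℝ, 2 ≤ Fintype.card ι → 0 ≤ θ → θ ≤ 1 →
      Fintype.card ι * θ ^ 3 ≤ δ → 1 / √(Fintype.card ι) ≤ δ → |y| ≤ δ * √(Fintype.card ι) →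
      (∃ m : ℤ, Fintype.card ι * s2 * θ + y = Fintype.card ι * a + m) →
      c / √(Fintype.card ι) * Real.exp (-(Fintype.card ι * s2 * θ ^ 2 / 2 + θ * y))
        ≤ P.real {ω | ∑ j, V j ω = Fintype.card ι * s2 * θ + y} := by
  obtain ⟨K, c, hK, hc, h⟩ := exists_le_re_mgf_pow_mul_exp hB hmean hvar hs2 ha ha'
  set D := Real.exp (-(s2 / 2)) with hD
  have hDpos : 0 < D := Real.exp_pos _
  -- `δ` makes the error term at most half of the main term `2 * D / √N`.
  set δ := min 1 (D / (3 * (K + 1) * √(Real.pi / c))) with hδ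
  have hδpos : 0 < δ := by positivity
  have hδ1 : δ ≤ 1 := min_le_left _ _
  have hδK : K * (3 * δ) * √(Real.pi / c) ≤ D := by
    have hpos : 0 < 3 * (K + 1) * √(Real.pi / c) := by positivity
    have h1 : δ * (3 * (K + 1) * √(Real.pi / c)) ≤ D := (le_div_iff₀ hpos).1 (min_le_right _ _)
    have h2 : 0 ≤ 3 * δ * √(Real.pi / c) := by positivity
    nlinarith
  refine ⟨D / (2 * Real.pi), δ, by positivity, hδpos, hδ1, ?_⟩
  intro ι _ Ω _ P _ V hV hind θ y hN h0 h1 hNθ hsN hy ⟨m, hm⟩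
  set N := Fintype.card ι with hNdef
  have hpi := Real.pi_pos
  set r : ℝ := N * s2 * θ + y with hr
  set F := Real.exp (-(N * s2 * θ ^ 2 / 2 + θ * y)) with hF
  have hFpos : 0 < F := Real.exp_pos _
  -- The sum is bounded and carried by `N * a + ℤ`, so the inversion formula applies.
  have hTm : AEMeasurable (fun ω ↦ ∑ j, V j ω) P := by
    have := fun j ↦ (hV j).aemeasurable
    fun_prop
  have hbd : ∀ᵐ ω ∂P, |∑ j, V j ω| ≤ N * B := by
    have : ∀ j, ∀ᵐ ω ∂P, |V j ω| ≤ B := fun j ↦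
      ae_of_ae_map (hV j).aemeasurable (p := fun v ↦ |v| ≤ B) ((hV j).map_eq ▸ hB)
    filter_upwards [ae_all_iff.2 this] with ω hω
    refine (Finset.abs_sum_le_sum_abs _ _).trans ((Finset.sum_le_sum fun j _ ↦ hω j).trans ?_)
    simp [hNdef]
  have hlatS : ∀ᵐ ω ∂P, ∃ l : ℤ, ∑ j, V j ω = r + l := by
    have : ∀ j, ∀ᵐ ω ∂P, ∃ l : ℤ, V j ω = a + l := fun j ↦
      ae_of_ae_map (hV j).aemeasurable (p := fun v ↦ ∃ l : ℤ, v = a + l) ((hV j).map_eq ▸ hlat)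
    filter_upwards [ae_all_iff.2 this] with ω hω
    choose l hl using hω
    refine ⟨∑ j, l j - m, ?_⟩
    rw [hm]
    simp only [hl, Finset.sum_add_distrib]
    simp [hNdef]
  have hinv := two_pi_mul_measureReal_eq hTm hbd hlatS θ
  simp_rw [integral_cexp_mul_sum_sub hV hind] at hinv
  have hcont : Continuous fun t : ℝ ↦ (∫ v : ℝ, Complex.exp ((θ + t * Complex.I) * v) ∂ρ) ^ N
      * Complex.exp (-((θ + t * Complex.I) * r)) := by
    refine Continuous.mul (Continuous.pow ?_ _) (by fun_prop)
    refine continuous_of_dominated (bound := fun v ↦ Real.exp (θ * v)) (fun t ↦ by fun_prop)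
      (fun t ↦ ae_of_all _ fun v ↦ ?_) (integrable_of_continuous_of_ae_abs_le hB (by fun_prop))
      (ae_of_all _ fun v ↦ by fun_prop)
    rw [Complex.norm_exp]
    simp
  have hre : 2 * Real.pi * P.real {ω | ∑ j, V j ω = r}
      = ∫ t in -Real.pi..Real.pi, ((∫ v : ℝ, Complex.exp ((θ + t * Complex.I) * v) ∂ρ) ^ N
        * Complex.exp (-((θ + t * Complex.I) * r))).re := by
    have h2 := congrArg Complex.re hinv
    rw [Complex.ofReal_re] at h2
    rw [h2]
    exact (Complex.reCLM.intervalIntegral_comp_comm (hcont.intervalIntegrable _ _)).symm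
  have hcF : Continuous fun t : ℝ ↦ Real.exp (-(N * s2 * t ^ 2 / 2)) := by fun_prop
  have hcE : Continuous fun t : ℝ ↦ Real.exp (-(c * N * t ^ 2)) := by fun_prop
  set ε := δ ^ 2 + N * θ ^ 3 + 1 / √(N : ℝ) with hε
  have hε3 : ε ≤ 3 * δ := by nlinarith
  have hmono : F * ((∫ t in -Real.pi..Real.pi, Real.exp (-(N * s2 * t ^ 2 / 2)))
      - K * ε * ∫ t in -Real.pi..Real.pi, Real.exp (-(c * N * t ^ 2)))
      ≤ 2 * Real.pi * P.real {ω | ∑ j, V j ω = r} := by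
    rw [hre, ← intervalIntegral.integral_const_mul, ← intervalIntegral.integral_sub
      (hcF.intervalIntegrable _ _) ((hcE.const_mul _).intervalIntegrable _ _),
      ← intervalIntegral.integral_const_mul]
    refine intervalIntegral.integral_mono_on (by linarith) ?_ ?_ fun t ht ↦ ?_
    · exact Continuous.intervalIntegrable (by fun_prop) _ _
    · exact (Complex.continuous_re.comp hcont).intervalIntegrable _ _
    · exact h N θ t y δ hN h0 h1 (abs_le.2 ht) (hNθ.trans hδ1) hy
  have hJ := div_sqrt_le_integral_exp_neg_mul_sq hs2.le (N := N) (by omega)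
  have hE := integral_exp_neg_mul_sq_le hc (N := N) (by omega)
  have hKε : K * ε * ∫ t in -Real.pi..Real.pi, Real.exp (-(c * N * t ^ 2)) ≤ D / √N := by
    have hE0 : 0 ≤ ∫ t in -Real.pi..Real.pi, Real.exp (-(c * N * t ^ 2)) :=
      intervalIntegral.integral_nonneg (by linarith) fun t _ ↦ (Real.exp_pos _).le
    calc _ ≤ K * (3 * δ) * (√(Real.pi / c) / √N) := by gcongr
      _ = K * (3 * δ) * √(Real.pi / c) / √N := by ring
      _ ≤ _ := by gcongr
  have hfin : F * (D / √N) ≤ 2 * Real.pi * P.real {ω | ∑ j, V j ω = r} := by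
    refine le_trans (mul_le_mul_of_nonneg_left ?_ hFpos.le) hmono
    have : 2 * D / √(N : ℝ) = D / √N + D / √N := by ring
    linarith
  calc D / (2 * Real.pi) / √N * F = F * (D / √N) / (2 * Real.pi) := by ring
    _ ≤ _ := by rw [div_le_iff₀ (by positivity)]; linarith

/-- Moderate deviations: the upper tail of a sum of `N` independent copies of a centred bounded
lattice variable is at least a constant multiple of the Gaussian tail `exp (-x ^ 2 / 2) / x`, as
long as `x ^ 3` is small compared with `√N`. -/
theorem exists_tail_lower_bound {ρ : Measure ℝ} [IsProbabilityMeasure ρ] {B s2 a : ℝ}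
    (hB : ∀ᵐ v ∂ρ, |v| ≤ B) (hmean : ∫ v, v ∂ρ = 0) (hvar : ∫ v, v ^ 2 ∂ρ = s2) (hs2 : 0 < s2)
    (hlat : ∀ᵐ v ∂ρ, ∃ m : ℤ, v = a + m) (ha : 0 < ρ {a}) (ha' : 0 < ρ {a + 1}) :
    ∃ c δ, 0 < c ∧ 0 < δ ∧ ∀ (ι : Type u) [Fintype ι] (Ω : Type v) [MeasurableSpace Ω]
      (P : Measure Ω) [IsProbabilityMeasure P] (V : ι → Ω → ℝ), (∀ j, HasLaw (V j) ρ P) →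
      iIndepFun V P → ∀ x : ℝ, 1 ≤ x → x ^ 3 ≤ δ * √(Fintype.card ι) →
      c * (Real.exp (-(x ^ 2 / 2)) / x)
        ≤ P.real {ω | x * √(Fintype.card ι) * √s2 < ∑ j, V j ω} := by
  obtain ⟨c, δ, hc, hδ, hδ1, h⟩ :=
    exists_local_lower_bound.{u, v} hB hmean hvar hs2 hlat ha ha'
  set s := √s2 with hs
  have hspos : 0 < s := Real.sqrt_pos.2 hs2
  have hss : s ^ 2 = s2 := Real.sq_sqrt hs2.le
  refine ⟨c * δ * Real.exp (-(δ / s)) / 2, min (min (δ * s ^ 3) (δ / 2)) s, by positivity,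
    by positivity, ?_⟩
  intro ι _ Ω _ P _ V hV hind x hx hxN
  set N := Fintype.card ι with hNdef
  set q := √(N : ℝ) with hq
  have hq0 : 0 ≤ q := Real.sqrt_nonneg _
  have hx3 : x ≤ x ^ 3 := le_self_pow₀ hx (by norm_num)
  have hxa : x ^ 3 ≤ δ * s ^ 3 * q :=
    hxN.trans (by gcongr; exact (min_le_left _ _).trans (min_le_left _ _))
  have hxb : x ^ 3 ≤ δ / 2 * q :=
    hxN.trans (by gcongr; exact (min_le_left _ _).trans (min_le_right _ _))
  have hxc : x ^ 3 ≤ s * q := hxN.trans (by gcongr; exact min_le_right _ _)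
  have hq2 : 2 ≤ q := by nlinarith
  have hqN : q ^ 2 = N := Real.sq_sqrt (Nat.cast_nonneg _)
  have hN : 2 ≤ N := by
    have : (2 : ℝ) ≤ N := by nlinarith
    exact_mod_cast this
  -- The tilt for which the mean `N * s2 * θ` is the level `x * q * s`.
  set θ := x / (s * q) with hθ
  have hθ0 : 0 ≤ θ := by positivity
  have hθ1 : θ ≤ 1 := (div_le_one (by positivity)).2 (by linarith)
  have hmeanθ : N * s2 * θ = x * q * s := by
    rw [hθ, ← hqN, ← hss]; field_simp
  have hvarθ : N * s2 * θ ^ 2 = x ^ 2 := by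
    rw [hθ, ← hqN, ← hss]; field_simp
  have hNθ : N * θ ^ 3 ≤ δ := by
    have : N * θ ^ 3 = x ^ 3 / (s ^ 3 * q) := by rw [hθ, ← hqN]; field_simp
    rw [this, div_le_iff₀ (by positivity)]; linarith
  have hsN : 1 / q ≤ δ := by
    rw [div_le_iff₀ (by positivity)]; nlinarith
  -- The window has length `L`, of the order of `1 / θ`, so that the tilt stays bounded on it.
  set L := δ * q / x with hL
  have hL2 : 2 ≤ L := by rw [hL, le_div_iff₀ (by positivity)]; linarith
  have hLq : L ≤ δ * q := div_le_self (by positivity) hx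
  have hθL : θ * L = δ / s := by rw [hθ, hL]; field_simp
  set u := x * q * s - N * a with hu
  set I := Finset.Ioc ⌊u⌋ ⌊u + L⌋ with hI
  have hcard : L / 2 ≤ (I.card : ℝ) := by
    have h1 : ((⌊u + L⌋ - ⌊u⌋ : ℤ) : ℝ) ≤ (I.card : ℝ) := by
      rw [hI, Int.card_Ioc]
      exact_mod_cast Int.self_le_toNat _
    have h2 := Int.lt_floor_add_one (u + L)
    have h3 := Int.floor_le u
    push_cast at h1
    linarith
  have hmem : ∀ m ∈ I, u < m ∧ (m : ℝ) ≤ u + L := fun m hm ↦ by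
    rw [hI, Finset.mem_Ioc] at hm
    exact ⟨Int.floor_lt.1 hm.1, Int.le_floor.1 hm.2⟩
  have hTm : AEMeasurable (fun ω ↦ ∑ j, V j ω) P := by
    have := fun j ↦ (hV j).aemeasurable
    fun_prop
  have hlocal : ∀ m ∈ I, c / q * (Real.exp (-(x ^ 2 / 2)) * Real.exp (-(δ / s)))
      ≤ (P.map fun ω ↦ ∑ j, V j ω).real {N * a + (m : ℝ)} := fun m hm ↦ by
    obtain ⟨hm1, hm2⟩ := hmem m hm
    set y := N * a + (m : ℝ) - x * q * s with hy
    have hy0 : 0 ≤ y := by linarith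
    have hyL : y ≤ L := by linarith
    have hloc := h ι Ω P V hV hind θ y hN hθ0 hθ1 hNθ hsN (by rw [abs_of_nonneg hy0]; linarith)
      ⟨m, by rw [hmeanθ, hy]; ring⟩
    have hr : N * s2 * θ + y = N * a + m := by rw [hmeanθ, hy]; ring
    rw [hr, hvarθ] at hloc
    rw [map_measureReal_apply_of_aemeasurable hTm (measurableSet_singleton _)]
    refine le_trans ?_ hloc
    rw [← Real.exp_add]
    gcongr
    have : θ * y ≤ θ * L := by gcongr
    linarith
  have hsum : ∑ m ∈ I, (P.map fun ω ↦ ∑ j, V j ω).real {N * a + (m : ℝ)}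
      ≤ P.real {ω | x * q * s < ∑ j, V j ω} := by
    have : IsProbabilityMeasure (P.map fun ω ↦ ∑ j, V j ω) := Measure.isProbabilityMeasure_map hTm
    have hinj : Set.InjOn (fun m : ℤ ↦ N * a + (m : ℝ)) I := fun m _ m' _ hmm ↦ by
      simpa using hmm
    have e1 := Finset.sum_image (f := fun r : ℝ ↦ (P.map fun ω ↦ ∑ j, V j ω).real {r}) hinj
    rw [← e1, sum_measureReal_singleton]
    have e2 : P.real {ω | x * q * s < ∑ j, V j ω}
        = (P.map fun ω ↦ ∑ j, V j ω).real (Set.Ioi (x * q * s)) := by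
      rw [map_measureReal_apply_of_aemeasurable hTm measurableSet_Ioi]; rfl
    rw [e2]
    refine measureReal_mono fun r hr ↦ ?_
    simp only [Finset.coe_image, Set.mem_image, Finset.mem_coe] at hr
    obtain ⟨m, hm, rfl⟩ := hr
    have := (hmem m hm).1
    simp only [Set.mem_Ioi]
    linarith
  refine le_trans ?_ ((Finset.card_nsmul_le_sum I _ _ hlocal).trans hsum)
  rw [nsmul_eq_mul]
  calc _ = L / 2 * (c / q * (Real.exp (-(x ^ 2 / 2)) * Real.exp (-(δ / s)))) := by
        rw [hL]; field_simp
    _ ≤ _ := by gcongr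

end

/-! ### The second moment method for pairwise negatively correlated events -/

section

variable {Ω : Type*} [MeasurableSpace Ω] {P : Measure Ω}

/-- The second moment method: Chebyshev's inequality for the number of events that occur, whose
variance is at most its mean when the events are pairwise negatively correlated. -/
theorem one_sub_inv_sum_le_measureReal_iUnion [IsProbabilityMeasure P] {ι : Type*} [Fintype ι]
    {A : ι → Set Ω} (hA : ∀ i, NullMeasurableSet (A i) P)
    (hneg : ∀ i j, i ≠ j → P.real (A i ∩ A j) ≤ P.real (A i) * P.real (A j))
    (hpos : 0 < ∑ i, P.real (A i)) :
    1 - (∑ i, P.real (A i))⁻¹ ≤ P.real (⋃ i, A i) := by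
  classical
  set s := ∑ i, P.real (A i) with hs
  set Z : ι → Ω → ℝ := fun i ↦ (A i).indicator fun _ ↦ 1 with hZ
  have hZm : ∀ i, AEStronglyMeasurable (Z i) P := fun i ↦
    aestronglyMeasurable_const.indicator₀ (hA i)
  have hZ2 : ∀ i, MemLp (Z i) 2 P := fun i ↦ by
    refine MemLp.of_bound (hZm i) 1 (ae_of_all _ fun ω ↦ ?_)
    by_cases h : ω ∈ A i <;> simp [hZ, h]
  have hZE : ∀ i, P[Z i] = P.real (A i) := fun i ↦ by
    simp [hZ, integral_indicator₀ (hA i), Measure.real]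
  have hZZ : ∀ i j, P[Z i * Z j] = P.real (A i ∩ A j) := fun i j ↦ by
    have : Z i * Z j = (A i ∩ A j).indicator fun _ ↦ 1 := by
      ext ω
      by_cases h : ω ∈ A i <;> by_cases h' : ω ∈ A j <;> simp [hZ, h, h']
    rw [this, integral_indicator₀ ((hA i).inter (hA j))]
    simp [Measure.real]
  have hcov : ∀ i j, cov[Z i, Z j; P] ≤ if i = j then P.real (A i) else 0 := fun i j ↦ by
    rw [covariance_eq_sub (hZ2 i) (hZ2 j), hZZ, hZE, hZE]
    split_ifs with h
    · subst h
      rw [Set.inter_self]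
      linarith [mul_self_nonneg (P.real (A i))]
    · linarith [hneg i j h]
  have hsumE : P[∑ i, Z i] = s := by
    simp only [Finset.sum_apply]
    rw [integral_finsetSum _ fun i _ ↦ (hZ2 i).integrable (by norm_num)]
    simp [hZE, hs]
  have hvar : Var[∑ i, Z i; P] ≤ s := by
    rw [variance_sum hZ2]
    refine (Finset.sum_le_sum fun i _ ↦ Finset.sum_le_sum fun j _ ↦ hcov i j).trans ?_
    simp [hs]
  have hcheb := meas_ge_le_variance_div_sq (memLp_finsetSum' Finset.univ fun i _ ↦ hZ2 i) hpos
  rw [hsumE] at hcheb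
  have hsub : (⋃ i, A i)ᶜ ⊆ {ω | s ≤ |(∑ i, Z i) ω - s|} := fun ω hω ↦ by
    have : (∑ i, Z i) ω = 0 := by
      rw [Finset.sum_apply]
      refine Finset.sum_eq_zero fun i _ ↦ ?_
      have hi : ω ∉ A i := fun h ↦ hω (Set.mem_iUnion.2 ⟨i, h⟩)
      simp [hZ, hi]
    simp only [Set.mem_ofPred_eq, this]
    simp [abs_of_pos hpos]
  have hcompl : P.real (⋃ i, A i)ᶜ ≤ s⁻¹ := by
    refine (measureReal_mono hsub).trans ?_
    refine ENNReal.toReal_le_of_le_ofReal (by positivity) (hcheb.trans ?_)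
    apply ENNReal.ofReal_le_ofReal
    calc Var[∑ i, Z i; P] / s ^ 2 ≤ s / s ^ 2 := by gcongr
      _ = s⁻¹ := by field_simp
  have := probReal_compl_eq_one_sub₀ (NullMeasurableSet.iUnion hA)
  linarith

/-- Chebyshev's association inequality for a monotone and an antitone function. -/
theorem integral_mul_le_of_monotone_antitone {ν : Measure ℝ} [IsProbabilityMeasure ν] {f g : ℝ → ℝ}
    (hf : Monotone f) (hg : Antitone g) (hfi : Integrable f ν) (hgi : Integrable g ν)
    (hfg : Integrable (fun x ↦ f x * g x) ν) :
    ∫ x, f x * g x ∂ν ≤ (∫ x, f x ∂ν) * ∫ x, g x ∂ν := by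
  have h0 : ∫ p : ℝ × ℝ, (f p.1 - f p.2) * (g p.1 - g p.2) ∂(ν.prod ν) ≤ 0 := by
    refine integral_nonpos fun p ↦ ?_
    rcases le_total p.1 p.2 with h | h
    · exact mul_nonpos_of_nonpos_of_nonneg (sub_nonpos.2 (hf h)) (sub_nonneg.2 (hg h))
    · exact mul_nonpos_of_nonneg_of_nonpos (sub_nonneg.2 (hf h)) (sub_nonpos.2 (hg h))
  have i1 : Integrable (fun p : ℝ × ℝ ↦ f p.1 * g p.1) (ν.prod ν) := hfg.comp_fst ν
  have i2 : Integrable (fun p : ℝ × ℝ ↦ f p.2 * g p.2) (ν.prod ν) := hfg.comp_snd ν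
  have i3 : Integrable (fun p : ℝ × ℝ ↦ f p.1 * g p.2) (ν.prod ν) := hfi.mul_prod hgi
  have i4 : Integrable (fun p : ℝ × ℝ ↦ g p.1 * f p.2) (ν.prod ν) := hgi.mul_prod hfi
  have e : ∀ p : ℝ × ℝ, (f p.1 - f p.2) * (g p.1 - g p.2)
      = f p.1 * g p.1 + f p.2 * g p.2 - (f p.1 * g p.2 + g p.1 * f p.2) := fun p ↦ by ring
  simp_rw [e] at h0
  have i5 : Integrable (fun p : ℝ × ℝ ↦ f p.1 * g p.1 + f p.2 * g p.2) (ν.prod ν) := i1.add i2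
  have i6 : Integrable (fun p : ℝ × ℝ ↦ f p.1 * g p.2 + g p.1 * f p.2) (ν.prod ν) := i3.add i4
  rw [integral_sub i5 i6, integral_add i1 i2, integral_add i3 i4,
    integral_prod_mul, integral_prod_mul, integral_fun_fst (f := fun x ↦ f x * g x),
    integral_fun_snd (f := fun x ↦ f x * g x)] at h0
  simp only [probReal_univ, one_smul] at h0
  linarith

/-- Disintegration of an event that depends on two independent random variables. -/
theorem measureReal_eq_integral_of_indepFun [IsProbabilityMeasure P] {β : Type*}
    [MeasurableSpace β] {X : Ω → ℝ} {Y : Ω → β} (hX : AEMeasurable X P) (hY : AEMeasurable Y P)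
    (h : IndepFun X Y P) {s : Set (ℝ × β)} (hs : MeasurableSet s) :
    P.real {ω | (X ω, Y ω) ∈ s} = ∫ x, P.real {ω | (x, Y ω) ∈ s} ∂(P.map X) := by
  have : IsProbabilityMeasure (P.map Y) := Measure.isProbabilityMeasure_map hY
  have e1 : P {ω | (X ω, Y ω) ∈ s} = ∫⁻ x, P {ω | (x, Y ω) ∈ s} ∂(P.map X) := by
    have h1 := Measure.map_apply_of_aemeasurable (hX.prodMk hY) hs
    rw [(indepFun_iff_map_prod_eq_prod_map_map hX hY).1 h, Measure.prod_apply hs] at h1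
    refine h1.symm.trans (lintegral_congr fun x ↦ ?_)
    exact Measure.map_apply_of_aemeasurable hY (measurable_prodMk_left hs)
  have e2 : ∀ x, P {ω | (x, Y ω) ∈ s} = (P.map Y) (Prod.mk x ⁻¹' s) := fun x ↦
    (Measure.map_apply_of_aemeasurable hY (measurable_prodMk_left hs)).symm
  simp only [Measure.real]
  rw [integral_toReal, e1]
  · simp_rw [e2]
    exact (measurable_measure_prodMk_left hs).aemeasurable
  · exact ae_of_all _ fun x ↦ measure_lt_top _ _

/-- Conditionally on `X`, the events `t < X + U` and `t < 1 - X + W` are independent, and their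
conditional probabilities are respectively monotone and antitone in `X`; hence they are negatively
correlated. -/
theorem measureReal_inter_le_mul [IsProbabilityMeasure P] {X U W : Ω → ℝ} (hX : AEMeasurable X P)
    (hU : AEMeasurable U P) (hW : AEMeasurable W P) (hXUW : IndepFun X (fun ω ↦ (U ω, W ω)) P)
    (hUW : IndepFun U W P) (t : ℝ) :
    P.real ({ω | t < X ω + U ω} ∩ {ω | t < 1 - X ω + W ω})
      ≤ P.real {ω | t < X ω + U ω} * P.real {ω | t < 1 - X ω + W ω} := by
  have hXU : IndepFun X U P := hXUW.comp measurable_id measurable_fst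
  have hXW : IndepFun X W P := hXUW.comp measurable_id measurable_snd
  have : IsProbabilityMeasure (P.map X) := Measure.isProbabilityMeasure_map hX
  set f : ℝ → ℝ := fun x ↦ P.real {ω | t < x + U ω} with hf
  set g : ℝ → ℝ := fun x ↦ P.real {ω | t < 1 - x + W ω} with hg
  have hfmono : Monotone f := fun x y hxy ↦ measureReal_mono fun ω (hω : t < x + U ω) ↦
    show t < y + U ω by linarith
  have hganti : Antitone g := fun x y hxy ↦ measureReal_mono fun ω (hω : t < 1 - y + W ω) ↦
    show t < 1 - x + W ω by linarith
  have hfb : ∀ x, ‖f x‖ ≤ 1 := fun x ↦ by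
    rw [Real.norm_of_nonneg measureReal_nonneg]; exact measureReal_le_one
  have hgb : ∀ x, ‖g x‖ ≤ 1 := fun x ↦ by
    rw [Real.norm_of_nonneg measureReal_nonneg]; exact measureReal_le_one
  have hfi : Integrable f (P.map X) :=
    .of_bound hfmono.measurable.aestronglyMeasurable 1 (ae_of_all _ hfb)
  have hgi : Integrable g (P.map X) :=
    .of_bound hganti.measurable.aestronglyMeasurable 1 (ae_of_all _ hgb)
  have hfgi : Integrable (fun x ↦ f x * g x) (P.map X) :=
    .of_bound (hfmono.measurable.mul hganti.measurable).aestronglyMeasurable 1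
      (ae_of_all _ fun x ↦ by
        rw [norm_mul]; exact mul_le_one₀ (hfb x) (norm_nonneg _) (hgb x))
  have e1 : P.real {ω | t < X ω + U ω} = ∫ x, f x ∂(P.map X) :=
    measureReal_eq_integral_of_indepFun hX hU hXU (s := {p : ℝ × ℝ | t < p.1 + p.2})
      (measurableSet_lt measurable_const (by fun_prop))
  have e2 : P.real {ω | t < 1 - X ω + W ω} = ∫ x, g x ∂(P.map X) :=
    measureReal_eq_integral_of_indepFun hX hW hXW (s := {p : ℝ × ℝ | t < 1 - p.1 + p.2})
      (measurableSet_lt measurable_const (by fun_prop))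
  have e3 : P.real ({ω | t < X ω + U ω} ∩ {ω | t < 1 - X ω + W ω})
      = ∫ x, f x * g x ∂(P.map X) := by
    refine (measureReal_eq_integral_of_indepFun hX (hU.prodMk hW) hXUW
      (s := {p : ℝ × ℝ × ℝ | t < p.1 + p.2.1} ∩ {p : ℝ × ℝ × ℝ | t < 1 - p.1 + p.2.2})
      ((measurableSet_lt measurable_const (by fun_prop)).inter
        (measurableSet_lt measurable_const (by fun_prop)))).trans ?_
    refine integral_congr_ae (ae_of_all _ fun x ↦ ?_)
    have h := hUW.measure_inter_preimage_eq_mul {u | t < x + u} {w | t < 1 - x + w}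
      (measurableSet_lt measurable_const (by fun_prop))
      (measurableSet_lt measurable_const (by fun_prop))
    have h' := congrArg ENNReal.toReal h
    rwa [ENNReal.toReal_mul] at h'
  rw [e1, e2, e3]
  exact integral_mul_le_of_monotone_antitone hfmono hganti hfi hgi hfgi

end

/-! ### Independence and negative correlation in the tournament -/

section Tournament

variable {k n : ℕ} {ν : Measure ℝ} {Ω : Type*} [MeasurableSpace Ω] {P : Measure Ω}
  {X : Fin n → Fin n → Ω → ℝ}

/-- Rewards taken from pairwise distinct games are independent, whichever of the two players each
reward belongs to. -/
theorem IsTournament.iIndepFun_of_injective (h : IsTournament k ν P X) {κ : Type*}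
    (p q : κ → Fin n) (hne : ∀ a, p a ≠ q a)
    (hinj : Function.Injective fun a ↦ s(p a, q a)) :
    iIndepFun (fun a ↦ X (p a) (q a)) P := by
  classical
  let e : κ → {e : Fin n × Fin n // e.1 < e.2} := fun a ↦
    if hlt : p a < q a then ⟨(p a, q a), hlt⟩
    else ⟨(q a, p a), lt_of_le_of_ne (not_lt.1 hlt) (hne a).symm⟩
  have he : ∀ a, s((e a).1.1, (e a).1.2) = s(p a, q a) := fun a ↦ by
    simp only [e]
    split_ifs
    · rfl
    · exact Sym2.eq_swap
  have heinj : Function.Injective e := fun a b hab ↦ hinj (by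
    simp only
    rw [← he a, ← he b, hab])
  have h1 := (h.indep.precomp heinj).comp
    (fun a (z : ℝ × ℝ) ↦ if p a < q a then z.1 else z.2) (fun a ↦ by split_ifs <;> fun_prop)
  refine h1.congr fun a ↦ ae_of_all _ fun ω ↦ ?_
  simp only [Function.comp, e]
  split_ifs <;> rfl

theorem IsTournament.aemeasurable (h : IsTournament k ν P X) {i j : Fin n} (hij : i ≠ j) :
    AEMeasurable (X i j) P := (h.hasLaw i j hij).aemeasurable

theorem IsTournament.aemeasurable_score (h : IsTournament k ν P X) (i : Fin n) :
    AEMeasurable (score X i) P :=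
  Finset.aemeasurable_fun_sum _ fun _ hj ↦ h.aemeasurable (Finset.ne_of_mem_erase hj).symm

/-- Two different players exceeding the level `t` are negatively correlated events: the two scores
share only the game between the two players, and that game rewards one at the expense of the
other. -/
theorem IsTournament.measureReal_inter_lt_score_le (h : IsTournament k ν P X) {i j : Fin n}
    (hij : i ≠ j) (t : ℝ) :
    P.real ({ω | t < score X i ω} ∩ {ω | t < score X j ω})
      ≤ P.real {ω | t < score X i ω} * P.real {ω | t < score X j ω} := by
  classical
  have := h.isProbabilityMeasure
  -- The games of `i` and `j`: their common game, the others of `i`, the others of `j`.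
  let β := {l : Fin n // l ≠ i ∧ l ≠ j}
  let p : Option (β ⊕ β) → Fin n := fun a ↦ a.elim i (Sum.elim (fun _ ↦ i) (fun _ ↦ j))
  let q : Option (β ⊕ β) → Fin n := fun a ↦ a.elim j (Sum.elim (fun l ↦ l) (fun l ↦ l))
  have hne : ∀ a, p a ≠ q a := by
    rintro (_ | ⟨l, hl⟩ | ⟨l, hl⟩)
    · exact hij
    · exact hl.1.symm
    · exact hl.2.symm
  have hinj : Function.Injective fun a ↦ s(p a, q a) := by
    rintro (_ | ⟨l, hl⟩ | ⟨l, hl⟩) (_ | ⟨l', hl'⟩ | ⟨l', hl'⟩) hab <;>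
      simp only [p, q, Option.elim, Sum.elim_inl, Sum.elim_inr, Sym2.eq_iff] at hab <;> grind
  have hind := h.iIndepFun_of_injective p q hne hinj
  set V : Option (β ⊕ β) → Ω → ℝ := fun a ↦ X (p a) (q a) with hV
  have hVm : ∀ a, AEMeasurable (V a) P := fun a ↦ h.aemeasurable (hne a)
  set U : Ω → ℝ := fun ω ↦ ∑ l : β, V (some (.inl l)) ω with hU
  set W : Ω → ℝ := fun ω ↦ ∑ l : β, V (some (.inr l)) ω with hW
  have hUm : AEMeasurable U P := by fun_prop
  have hWm : AEMeasurable W P := by fun_prop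
  have hXUW : IndepFun (X i j) (fun ω ↦ (U ω, W ω)) P := by
    have h1 := hind.indepFun_finset₀ {none} {none}ᶜ disjoint_compl_right hVm
    refine h1.comp (φ := fun y ↦ y ⟨none, by simp⟩)
      (ψ := fun y ↦ (∑ l : β, y ⟨some (.inl l), by simp⟩, ∑ l : β, y ⟨some (.inr l), by simp⟩))
      ?_ ?_ <;> fun_prop
  have hUW : IndepFun U W P := by
    have h1 := hind.indepFun_finset₀ (Finset.univ.image fun l : β ↦ some (.inl l))
      (Finset.univ.image fun l : β ↦ some (.inr l)) (by
        rw [Finset.disjoint_left]; simp) hVm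
    refine h1.comp (φ := fun y ↦ ∑ l : β, y ⟨some (.inl l), by simp⟩)
      (ψ := fun y ↦ ∑ l : β, y ⟨some (.inr l), by simp⟩) ?_ ?_ <;> fun_prop
  have hsi : ∀ ω, score X i ω = X i j ω + U ω := fun ω ↦ by
    rw [score, ← Finset.add_sum_erase _ _ (show j ∈ Finset.univ.erase i by simp [hij.symm]),
      Finset.sum_subtype (p := fun l ↦ l ≠ i ∧ l ≠ j) (F := inferInstanceAs (Fintype β)) _
        (by simp [and_comm])]
    rfl
  have hsj : ∀ ω, score X j ω = X j i ω + W ω := fun ω ↦ by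
    rw [score, ← Finset.add_sum_erase _ _ (show i ∈ Finset.univ.erase j by simp [hij]),
      Finset.sum_subtype (p := fun l ↦ l ≠ i ∧ l ≠ j) (F := inferInstanceAs (Fintype β)) _
        (by simp)]
    rfl
  have hkey := measureReal_inter_le_mul (h.aemeasurable hij) hUm hWm hXUW hUW t
  have hji : {ω | t < score X j ω} =ᵐ[P] {ω | t < 1 - X i j ω + W ω} := by
    filter_upwards [h.add_eq_one i j hij] with ω hω
    apply propext
    show t < score X j ω ↔ t < 1 - X i j ω + W ω
    rw [hsj, ← hω]; ring_nf
  have hii : {ω | t < score X i ω} = {ω | t < X i j ω + U ω} := by simp only [hsi]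
  rw [hii, measureReal_congr hji, measureReal_congr ((ae_eq_refl _).inter hji)]
  exact hkey

end Tournament

/-! ### Moderate deviations of a single score -/

section Score

universe u

variable {k : ℕ} {ν : Measure ℝ}

theorem IsPayoffLaw.ae_abs_le_one (hν : IsPayoffLaw k ν) : ∀ᵐ a ∂ν, |a| ≤ 1 := by
  filter_upwards [hν.ae_mem] with a ⟨m, hm, ha⟩
  rw [ha, abs_of_nonneg (by positivity)]
  exact div_le_one_of_le₀ (by exact_mod_cast hm) (by positivity)

/-- The Gaussian lower bound for the upper tail of a score, in the range of moderate deviations. The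
rewards are centred and multiplied by `k`, which puts them on a translate of `ℤ`, with two adjacent
atoms coming from the rewards `0` and `1 / k`. -/
theorem exists_score_tail_lower_bound (hk : 1 ≤ k) (hν : IsPayoffLaw k ν) :
    ∃ c δ, 0 < c ∧ 0 < δ ∧ ∀ (n : ℕ) (Ω : Type u) [MeasurableSpace Ω] (P : Measure Ω)
      (X : Fin n → Fin n → Ω → ℝ), IsTournament k ν P X → ∀ (i : Fin n) (x : ℝ), 1 ≤ x →
      x ^ 3 ≤ δ * √((n : ℝ) - 1) →
      c * (Real.exp (-(x ^ 2 / 2)) / x)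
        ≤ P.real {ω | ((n : ℝ) - 1) * mean ν + x * √((n : ℝ) - 1) * stdDev ν < score X i ω} := by
  have := hν.isProbabilityMeasure
  have hk0 : (0 : ℝ) < k := by exact_mod_cast hk
  set m₀ := mean ν with hm₀
  set φ : ℝ → ℝ := fun a ↦ k * (a - m₀) with hφ
  have hφm : Measurable φ := by fun_prop
  set ρ := ν.map φ with hρ
  have : IsProbabilityMeasure ρ := Measure.isProbabilityMeasure_map hφm.aemeasurable
  have hφB : ∀ᵐ a ∂ν, |φ a| ≤ k * (1 + |m₀|) := by
    filter_upwards [hν.ae_abs_le_one] with a ha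
    rw [hφ, abs_mul, Nat.abs_cast]
    gcongr
    exact (abs_sub _ _).trans (by gcongr)
  have hB : ∀ᵐ v ∂ρ, |v| ≤ k * (1 + |m₀|) :=
    (ae_map_iff hφm.aemeasurable (measurableSet_le (by fun_prop) (by fun_prop))).2 hφB
  have hid : Integrable (fun a : ℝ ↦ a) ν :=
    integrable_of_continuous_of_ae_abs_le hν.ae_abs_le_one continuous_id
  have hmean : ∫ v, v ∂ρ = 0 := by
    rw [hρ, integral_map hφm.aemeasurable (by fun_prop)]
    simp only [hφ]
    rw [integral_const_mul, integral_sub hid (integrable_const _)]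
    simp [hm₀, mean]
  have hvar : ∫ v, v ^ 2 ∂ρ = k ^ 2 * Var[fun a : ℝ ↦ a; ν] := by
    rw [hρ, integral_map hφm.aemeasurable (by fun_prop), variance_eq_integral (by fun_prop),
      ← integral_const_mul]
    simp only [hφ, mul_pow]
    rfl
  have hlat : ∀ᵐ v ∂ρ, ∃ m : ℤ, v = -(k * m₀) + m := by
    have hset : {v : ℝ | ∃ m : ℤ, v = -(k * m₀) + m} = Set.range fun m : ℤ ↦ -(k * m₀) + (m : ℝ) := by
      ext v; simp [eq_comm]
    refine (ae_map_iff hφm.aemeasurable (hset ▸ (Set.countable_range _).measurableSet)).2 ?_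
    filter_upwards [hν.ae_mem] with a ⟨m, hm, ha⟩
    exact ⟨m, by rw [hφ, ha]; push_cast; field_simp; ring⟩
  have hatom : ∀ m : ℕ, m ≤ k → 0 < ρ {-(k * m₀) + (m : ℝ)} := fun m hm ↦ by
    rw [hρ, Measure.map_apply hφm (measurableSet_singleton _)]
    refine (hν.pos (m / k) ⟨m, hm, rfl⟩).trans_le (measure_mono ?_)
    rintro _ rfl
    simp only [hφ, Set.mem_preimage, Set.mem_singleton_iff]
    field_simp; ring
  have ha : 0 < ρ {-(k * m₀)} := by simpa using hatom 0 (Nat.zero_le k)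
  have ha' : 0 < ρ {-(k * m₀) + 1} := by simpa using hatom 1 hk
  have hpos : 0 < k ^ 2 * Var[fun a : ℝ ↦ a; ν] := by
    rw [← hvar]
    refine lt_of_le_of_ne (integral_nonneg fun v ↦ sq_nonneg v) fun h0 ↦ ?_
    have h1 := (integral_eq_zero_iff_of_nonneg (fun v ↦ sq_nonneg v)
      (integrable_of_continuous_of_ae_abs_le hB (by fun_prop))).1 h0.symm
    have h2 : ∀ v, 0 < ρ {v} → v = 0 := fun v hv ↦ by
      by_contra hne
      refine hv.ne' (measure_mono_null ?_ (ae_iff.1 h1))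
      rintro _ rfl
      simpa using hne
    linarith [h2 _ ha, h2 _ ha']
  obtain ⟨c, δ, hc, hδ, h⟩ :=
    exists_tail_lower_bound.{0, u} hB hmean hvar hpos hlat ha ha'
  refine ⟨c, δ, hc, hδ, fun n Ω _ P X hX i x hx hxn ↦ ?_⟩
  have := hX.isProbabilityMeasure
  have hcard : (Fintype.card {j : Fin n // j ≠ i} : ℝ) = (n : ℝ) - 1 := by
    have hn : 1 ≤ n := Fin.pos i
    rw [Fintype.card_subtype_compl, Fintype.card_fin, Fintype.card_subtype_eq]
    push_cast [hn]; ring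
  have hV : ∀ j : {j : Fin n // j ≠ i}, HasLaw (fun ω ↦ φ (X i j ω)) ρ P := fun j ↦
    HasLaw.fun_comp ⟨hφm.aemeasurable, rfl⟩ (hX.hasLaw i j j.2.symm)
  have hind : iIndepFun (fun (j : {j : Fin n // j ≠ i}) ω ↦ φ (X i j ω)) P := by
    refine (hX.iIndepFun_of_injective (fun _ : {j : Fin n // j ≠ i} ↦ i) (fun j ↦ j)
      (fun j ↦ j.2.symm) fun j j' hjj ↦ ?_).comp (fun _ ↦ φ) fun _ ↦ hφm
    simp only [Sym2.eq_iff] at hjj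
    have := j.2
    grind
  have htail := h {j : Fin n // j ≠ i} Ω P _ hV hind x hx (by rwa [hcard])
  rw [hcard] at htail
  refine htail.trans (measureReal_mono fun ω hω ↦ ?_)
  have hsum : ∑ j : {j : Fin n // j ≠ i}, φ (X i j ω) = k * (score X i ω - ((n : ℝ) - 1) * m₀) := by
    rw [score, Finset.sum_subtype (p := fun j ↦ j ≠ i) _ (by simp), ← Finset.mul_sum,
      Finset.sum_sub_distrib, Finset.sum_const, Finset.card_univ, nsmul_eq_mul, hcard]
  have hsq : √(k ^ 2 * Var[fun a : ℝ ↦ a; ν]) = k * stdDev ν := by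
    rw [Real.sqrt_mul (by positivity), Real.sqrt_sq hk0.le]; rfl
  simp only [Set.mem_ofPred_eq] at hω ⊢
  rw [hsum, hsq, show x * √((n : ℝ) - 1) * (k * stdDev ν)
    = k * (x * √((n : ℝ) - 1) * stdDev ν) by ring] at hω
  linarith [lt_of_mul_lt_mul_left hω hk0.le]

end Score

/-! ### The sequence of thresholds -/

theorem eventually_deviation_bounds {ε δ : ℝ} (hε : 0 < ε) (hδ : 0 < δ) :
    ∀ᶠ n : ℕ in atTop, 1 ≤ deviation ε n ∧ (deviation ε n) ^ 3 ≤ δ * √((n : ℝ) - 1) ∧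
      (Real.log ((n : ℝ) - 1)) ^ (ε / 2) / √2
        ≤ n * (Real.exp (-(deviation ε n ^ 2 / 2)) / deviation ε n) := by
  have hN : Tendsto (fun n : ℕ ↦ (n : ℝ) - 1) atTop atTop :=
    tendsto_atTop_add_const_right _ _ tendsto_natCast_atTop_atTop
  have hlog := Real.tendsto_log_atTop.comp hN
  have hloglog : ∀ᶠ n : ℕ in atTop, (1 + ε) * Real.log (Real.log ((n : ℝ) - 1))
      ≤ Real.log ((n : ℝ) - 1) := by
    have h := (Real.isLittleO_log_id_atTop.bound (show 0 < 1 / (1 + ε) by positivity))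
    filter_upwards [hlog.eventually h, hlog.eventually_ge_atTop 1] with n hn hn1
    simp only [Function.comp, id, Real.norm_eq_abs] at hn hn1
    have h1 := (le_abs_self _).trans hn
    rw [abs_of_nonneg (by linarith), one_div, ← div_eq_inv_mul, le_div_iff₀ (by positivity)] at h1
    linarith
  have hcube : ∀ᶠ n : ℕ in atTop, √(2 * Real.log ((n : ℝ) - 1)) ^ 3 ≤ δ * √((n : ℝ) - 1) := by
    have h := (Real.isLittleO_pow_log_id_atTop (n := 3)).bound (show 0 < δ ^ 2 / 8 by positivity)
    filter_upwards [hN.eventually h, hlog.eventually_ge_atTop 1, hN.eventually_ge_atTop 1]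
      with n hn hn1 hN1
    simp only [Function.comp, id, Real.norm_eq_abs] at hn hn1
    rw [abs_of_nonneg (by positivity), abs_of_nonneg (by linarith)] at hn
    rw [← pow_le_pow_iff_left₀ (by positivity) (by positivity) (two_ne_zero), mul_pow,
      Real.sq_sqrt (by linarith), ← pow_mul, mul_comm 3 2, pow_mul, Real.sq_sqrt (by linarith)]
    calc (2 * Real.log ((n : ℝ) - 1)) ^ 3 = 8 * Real.log ((n : ℝ) - 1) ^ 3 := by ring
      _ ≤ _ := by linarith
  filter_upwards [hloglog, hcube, hlog.eventually_ge_atTop 1, hN.eventually_ge_atTop 1]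
    with n h1 h2 h3 h4
  simp only [Function.comp] at h3
  set N : ℝ := (n : ℝ) - 1 with hNdef
  set l := Real.log N with hl
  have hll : 0 ≤ Real.log l := Real.log_nonneg h3
  set x := deviation ε n with hx
  have hrad : 0 ≤ 2 * l - (1 + ε) * Real.log l := by linarith
  have hx2 : x ^ 2 = 2 * l - (1 + ε) * Real.log l := Real.sq_sqrt hrad
  have hx1 : 1 ≤ x := Real.one_le_sqrt.2 (by linarith)
  have hxl : x ≤ √(2 * l) := Real.sqrt_le_sqrt (by
    have : 0 ≤ (1 + ε) * Real.log l := by positivity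
    linarith)
  refine ⟨hx1, le_trans (by gcongr) h2, ?_⟩
  have hexp : Real.exp (-(x ^ 2 / 2)) = N⁻¹ * l ^ ((1 + ε) / 2) := by
    have hNinv : N⁻¹ = Real.exp (-l) := by rw [Real.exp_neg, Real.exp_log (by linarith)]
    rw [hx2, Real.rpow_def_of_pos (by linarith), hNinv, ← Real.exp_add]
    congr 1; ring
  rw [hexp]
  have hl2 : l ^ ((1 + ε) / 2) = l ^ (ε / 2) * √l := by
    rw [Real.sqrt_eq_rpow, ← Real.rpow_add (by linarith)]; congr 1; ring
  have hsl : 0 < √l := Real.sqrt_pos.2 (by linarith)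
  have hlε : 0 ≤ l ^ (ε / 2) := by positivity
  calc l ^ (ε / 2) / √2 = l ^ (ε / 2) * √l / √(2 * l) := by
        rw [Real.sqrt_mul (by norm_num)]; field_simp
    _ ≤ l ^ (ε / 2) * √l / x := by gcongr
    _ = N * (N⁻¹ * (l ^ (ε / 2) * √l) / x) := by field_simp
    _ ≤ n * (N⁻¹ * (l ^ (ε / 2) * √l) / x) := by
        gcongr
        linarith
    _ = _ := by rw [hl2]

end RoundRobin

/-! ### The maximal score -/

theorem proposition1 (k : ℕ) (hk : 1 ≤ k) (ν : Measure ℝ) (ε : ℝ) (hε : 0 < ε)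
    {Ω : ℕ → Type*} [∀ n, MeasurableSpace (Ω n)] (P : ∀ n, Measure (Ω n))
    (X : ∀ n, Fin n → Fin n → Ω n → ℝ)
    (hX : ∀ n, RoundRobin.IsTournament k ν (P n) (X n)) :
    Tendsto
      (fun n => (P n).real {ω | RoundRobin.threshold ν ε n < RoundRobin.maxScore (X n) ω})
      atTop (𝓝 1) := by
  obtain ⟨c, δ, hc, hδ, htail⟩ := RoundRobin.exists_score_tail_lower_bound hk (hX 0).isPayoffLaw
  have hlog : Tendsto (fun n : ℕ ↦ Real.log ((n : ℝ) - 1)) atTop atTop :=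
    Real.tendsto_log_atTop.comp (tendsto_atTop_add_const_right _ _ tendsto_natCast_atTop_atTop)
  have hlower : Tendsto (fun n : ℕ ↦ 1 - (c * (Real.log ((n : ℝ) - 1) ^ (ε / 2) / √2))⁻¹)
      atTop (𝓝 1) := by
    have h : Tendsto (fun n : ℕ ↦ c * (Real.log ((n : ℝ) - 1) ^ (ε / 2) / √2)) atTop atTop :=
      (((tendsto_rpow_atTop (half_pos hε)).comp hlog).atTop_div_const (by positivity)).const_mul_atTop
        hc
    simpa using h.inv_tendsto_atTop.const_sub 1
  refine tendsto_of_tendsto_of_tendsto_of_le_of_le' hlower tendsto_const_nhds ?_ ?_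
  · filter_upwards [RoundRobin.eventually_deviation_bounds hε hδ, hlog.eventually_ge_atTop 1,
      eventually_ge_atTop 1] with n ⟨h1, h2, h3⟩ hl hn
    have := (hX n).isProbabilityMeasure
    have : Nonempty (Fin n) := ⟨⟨0, hn⟩⟩
    set A : Fin n → Set (Ω n) := fun i ↦
      {ω | RoundRobin.threshold ν ε n < RoundRobin.score (X n) i ω} with hA
    have hmax : {ω | RoundRobin.threshold ν ε n < RoundRobin.maxScore (X n) ω} = ⋃ i, A i := by
      ext ω
      simp only [RoundRobin.maxScore, Set.mem_iUnion, hA]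
      exact lt_ciSup_iff (Set.finite_range fun i ↦ RoundRobin.score (X n) i ω).bddAbove
    have hAi : ∀ i, c * (Real.exp (-(RoundRobin.deviation ε n ^ 2 / 2))
        / RoundRobin.deviation ε n) ≤ (P n).real (A i) := fun i ↦
      htail n (Ω n) (P n) (X n) (hX n) i _ h1 h2
    have hsum : c * (Real.log ((n : ℝ) - 1) ^ (ε / 2) / √2) ≤ ∑ i, (P n).real (A i) := by
      calc _ ≤ c * (n * (Real.exp (-(RoundRobin.deviation ε n ^ 2 / 2))
            / RoundRobin.deviation ε n)) := by gcongr
        _ = ∑ i : Fin n, c * (Real.exp (-(RoundRobin.deviation ε n ^ 2 / 2))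
            / RoundRobin.deviation ε n) := by
            rw [Finset.sum_const, Finset.card_univ, Fintype.card_fin, nsmul_eq_mul]; ring
        _ ≤ _ := Finset.sum_le_sum fun i _ ↦ hAi i
    have hlow : 0 < c * (Real.log ((n : ℝ) - 1) ^ (ε / 2) / √2) := by
      have : 0 < Real.log ((n : ℝ) - 1) := by linarith
      positivity
    rw [hmax]
    refine le_trans ?_ (RoundRobin.one_sub_inv_sum_le_measureReal_iUnion (fun i ↦ ?_)
      (fun i j hij ↦ (hX n).measureReal_inter_lt_score_le hij _) (hlow.trans_le hsum))
    · gcongr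
    · exact ((hX n).aemeasurable_score i).nullMeasurable measurableSet_Ioi
  · filter_upwards with n
    have := (hX n).isProbabilityMeasure
    exact measureReal_le_one
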